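/- **Proposition (Birkhoff normal form).** Let $\mathbb N^{\mathbb Z}_f$ and $\mathbb Z^{\mathbb Z}_f$ denote the finitely supported sequences $\mathbb Z\to\mathbb N$ (with $0\in\mathbb N$) and $\mathbb Z\to\mathbb Z$, let $e_j$ be the $j$-th unit vector, and write $|\alpha|=\sum_j\alpha_j$. Let $\mathcal F$ be the real vector space of formal power series $$H=\sum_{\alpha,\beta\in\mathbb N^{\mathbb Z}_f}H_{\alpha,\beta}\,u^\alpha\bar u^\beta,\qquad u=(u_j)_{j\in\mathbb Z},\quad H_{\alpha,\beta}\in\mathbb C,$$ such that $H_{0,0}=H_{e_0,0}=H_{0,e_0}=0$; $H_{\alpha,\beta}=\overline{H_{\beta,\alpha}}$ for all $\alpha,\beta$; and $H_{\alpha,\beta}=0$ whenever $\sum_{j} j(\alpha_j-\beta_j)\neq0$. For $d\in\mathbb N$ let $\mathcal F^{\ge d}$ be the set of $H\in\mathcal F$ with $H_{\alpha,\beta}=0$ whenever $|\alpha|+|\beta|<d+2$. Let $\mathcal K$ be the set of $H\in\mathcal F$ with $H_{\alpha,\beta}=0$ whenever $\alpha\ne\beta$ (series depending only on the actions $|u_j|^2$),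 and $\mathcal K^{\ge d}=\mathcal K\cap\mathcal F^{\ge d}$. For $F,G\in\mathcal F$ put $$\{F,G\}=\mathrm i\sum_{\alpha^{(1)},\beta^{(1)},\alpha^{(2)},\beta^{(2)}}F_{\alpha^{(1)},\beta^{(1)}}G_{\alpha^{(2)},\beta^{(2)}}\sum_{j}\bigl(\alpha^{(1)}_j\beta^{(2)}_j-\beta^{(1)}_j\alpha^{(2)}_j\bigr)u^{\alpha^{(1)}+\alpha^{(2)}-e_j}\,\bar u^{\beta^{(1)}+\beta^{(2)}-e_j},$$ and for $G\in\mathcal F^{\ge1}$ put $e^{\{G,\cdot\}}=\sum_{k\ge0}\frac1{k!}\,\mathrm{ad}_G^k$ with $\mathrm{ad}_G=\{G,\cdot\}$ (in both definitions each coefficient is a finite sum). Let $\omega\in\mathbb R^{\mathbb Z}$ be non-resonant, that is, $\sum_j\omega_j\ell_j\neq0$ for all $\ell\in\mathbb Z^{\mathbb Z}_f\setminus\{0\}$, and let $D_\omega=\sum_j\omega_j|u_j|^2$. Let $d\ge1$ be an integer and let $$H=D_\omega+Z+R,\qquad Z\in\mathcal K^{\ge2},\quad R\in\mathcal F^{\ge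 d}.$$ 1. (Formal normal form.) There exist $S\in\mathcal F^{\ge d}$ and $\widetilde Z\in\mathcal K$ such that $e^{\{S,\cdot\}}H=D_\omega+\widetilde Z$ and $\widetilde Z-Z\in\mathcal K^{\ge d}$. 2. (Uniqueness.) If $S$ is as in 1 and $G\in\mathcal F^{\ge1}$ is such that $e^{\{G,\cdot\}}H\in\mathcal K$, then $e^{\{G,\cdot\}}H=e^{\{S,\cdot\}}H$. Hence there is a unique $Z_H\in\mathcal K^{\ge2}$ such that $e^{\{S,\cdot\}}H=D_\omega+Z_H$ for some $S\in\mathcal F^{\ge1}$. -/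

import Mathlib

namespace FormalBirkhoff

open Finsupp (single)

/-- Finitely supported multi-indices `α ∈ ℕ_f^ℤ`. -/
abbrev MultiIndex : Type := ℤ →₀ ℕ

/-- A formal power series `∑ H_{α,β} u^α ū^β` in `u ∈ ℂ^ℤ`, given by its coefficients
`H α β = H_{α,β}`. -/
abbrev FormalSeries : Type := MultiIndex → MultiIndex → ℂ

/-- The momentum `π(α,β) = ∑_j j (α_j - β_j)`. -/
def momentum (α β : MultiIndex) : ℤ :=
  (α.sum fun j n => j * (n : ℤ)) - (β.sum fun j n => j * (n : ℤ))

/-- The real vector space `𝓕` of formal Hamiltonians: no constant term, no linear term in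
`u_0, ū_0`, the reality condition, and momentum conservation. -/
noncomputable def formalHam : Submodule ℝ FormalSeries where
  carrier := {H | (H 0 0 = 0 ∧ H (single 0 1) 0 = 0 ∧ H 0 (single 0 1) = 0) ∧
    (∀ α β, H α β = (starRingEnd ℂ) (H β α)) ∧
    (∀ α β, momentum α β ≠ 0 → H α β = 0)}
  zero_mem' := by simp
  add_mem' := by
    rintro F G ⟨⟨a1, a2, a3⟩, a4, a5⟩ ⟨⟨b1, b2, b3⟩, b4, b5⟩
    refine ⟨by simp [a1, a2, a3, b1, b2, b3], fun α β => ?_, fun α β h => ?_⟩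
    · simp [← a4, ← b4]
    · simp [a5 α β h, b5 α β h]
  smul_mem' := by
    rintro c F ⟨⟨a1, a2, a3⟩, a4, a5⟩
    refine ⟨by simp [a1, a2, a3], fun α β => ?_, fun α β h => ?_⟩
    · simp [← a4]
    · simp [a5 α β h]

/-- `𝓕^{≥ d}`: formal Hamiltonians all of whose monomials have degree
`|α| + |β| ≥ d + 2`. -/
noncomputable def orderGE (d : ℕ) : Submodule ℝ FormalSeries where
  carrier := {H | H ∈ formalHam ∧ ∀ α β, α.degree + β.degree < d + 2 → H α β = 0}
  zero_mem' := ⟨formalHam.zero_mem, by simp⟩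
  add_mem' := by
    rintro F G ⟨a1, a2⟩ ⟨b1, b2⟩
    exact ⟨formalHam.add_mem a1 b1, fun α β h => by simp [a2 α β h, b2 α β h]⟩
  smul_mem' := by
    rintro c F ⟨a1, a2⟩
    exact ⟨formalHam.smul_mem c a1, fun α β h => by simp [a2 α β h]⟩

/-- `𝓚`: formal Hamiltonians of the form `∑ Z_{α,α} |u|^{2α}`, that is, depending only on
the actions `|u_j|²`. -/
noncomputable def actionHam : Submodule ℝ FormalSeries where
  carrier := {Z | Z ∈ formalHam ∧ ∀ α β, α ≠ β → Z α β = 0}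
  zero_mem' := ⟨formalHam.zero_mem, by simp⟩
  add_mem' := by
    rintro F G ⟨a1, a2⟩ ⟨b1, b2⟩
    exact ⟨formalHam.add_mem a1 b1, fun α β h => by simp [a2 α β h, b2 α β h]⟩
  smul_mem' := by
    rintro c F ⟨a1, a2⟩
    exact ⟨formalHam.smul_mem c a1, fun α β h => by simp [a2 α β h]⟩

/-- `𝓚^{≥ d} = 𝓚 ∩ 𝓕^{≥ d}`. -/
noncomputable def actionGE (d : ℕ) : Submodule ℝ FormalSeries := actionHam ⊓ orderGE d

/-- The contribution of the index `j` to the coefficient of `u^α ū^β` in `-i {F, G}`. -/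
noncomputable def bracketTerm (F G : FormalSeries) (α β : MultiIndex) (j : ℤ) : ℂ :=
  ∑ x ∈ Finset.HasAntidiagonal.antidiagonal (α + single j 1), ∑ y ∈ Finset.HasAntidiagonal.antidiagonal (β + single j 1),
    F x.1 y.1 * G x.2 y.2 * ((x.1 j : ℂ) * (y.2 j : ℂ) - (y.1 j : ℂ) * (x.2 j : ℂ))

/-- The Poisson bracket
`{F,G} = i ∑ F_{α¹,β¹} G_{α²,β²} ∑_j (α¹_j β²_j - β¹_j α²_j) u^{α¹+α²-e_j} ū^{β¹+β²-e_j}`.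
For `F, G` in `formalHam` only finitely many `j` contribute to a given coefficient, see
`finite_support_bracketTerm`. -/
noncomputable def bracket (F G : FormalSeries) : FormalSeries :=
  fun α β => Complex.I * ∑ᶠ j : ℤ, bracketTerm F G α β j

/-- The formal symplectic change of variables `e^{{G,·}} H = ∑_{k ≥ 0} ad_G^k H / k!`, with
`ad_G = {G,·}`, computed coefficient by coefficient. For `G ∈ 𝓕^{≥ 1}` and `H ∈ 𝓕` only
finitely many `k` contribute to a given coefficient, see `finite_support_expAd`. -/
noncomputable def expAd (G H : FormalSeries) : FormalSeries :=
  fun α β => ∑ᶠ k : ℕ, ((k.factorial : ℂ)⁻¹) * ((bracket G)^[k] H) α β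

/-- The quadratic Hamiltonian `D_ω = ∑_j ω_j |u_j|²`. -/
noncomputable def quadHam (ω : ℤ → ℝ) : FormalSeries :=
  fun α β => ∑ᶠ j : ℤ, if α = single j 1 ∧ β = single j 1 then (ω j : ℂ) else 0

/-- Non-resonance: `ω · ℓ ≠ 0` for every nonzero finitely supported integer vector `ℓ`. -/
def NonResonant (ω : ℤ → ℝ) : Prop :=
  ∀ ℓ : ℤ →₀ ℤ, ℓ ≠ 0 → (ℓ.sum fun j n => ω j * (n : ℝ)) ≠ 0

/-! Well-definedness of the bracket and of the formal exponential. -/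

lemma momentum_add (α β α' β' : MultiIndex) :
    momentum (α + α') (β + β') = momentum α β + momentum α' β' := by
  have h : ∀ a b : MultiIndex, ((a + b).sum fun j n => j * (n : ℤ)) =
      (a.sum fun j n => j * (n : ℤ)) + (b.sum fun j n => j * (n : ℤ)) := fun a b =>
    Finsupp.sum_add_index' (by simp) (by intros; push_cast; ring)
  simp only [momentum, h]
  ring

lemma momentum_single (j : ℤ) : momentum (single j 1) 0 = j ∧ momentum 0 (single j 1) = -j := by
  simp [momentum]

lemma momentum_diag (j : ℤ) : momentum (single j 1) (single j 1) = 0 := by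
  simp [momentum]

/-- Every formal Hamiltonian has order at least `0`. -/
lemma mem_orderGE_zero {H : FormalSeries} (hH : H ∈ formalHam) : H ∈ orderGE 0 := by
  refine ⟨hH, fun α β h => ?_⟩
  obtain ⟨⟨h0, h1, h2⟩, -, hm⟩ := hH
  have key : ∀ a : MultiIndex, a.degree = 1 → ∃ j, a = single j 1 := fun a ha => by
    have hne : a ≠ 0 := by rintro rfl; simp at ha
    obtain ⟨j, hj⟩ := Finsupp.ne_iff.1 hne
    have hle : single j 1 ≤ a := by
      rw [Finsupp.single_le_iff]
      exact Nat.one_le_iff_ne_zero.2 hj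
    refine ⟨j, ?_⟩
    have h := tsub_add_cancel_of_le hle
    have h' := congrArg Finsupp.degree h
    rw [map_add, Finsupp.degree_single, ha] at h'
    rw [(Finsupp.degree_eq_zero_iff (a - single j 1)).1 (by omega), zero_add] at h
    exact h.symm
  rcases Nat.eq_zero_or_pos α.degree with ha | ha
  · obtain rfl := (Finsupp.degree_eq_zero_iff α).1 ha
    rcases Nat.eq_zero_or_pos β.degree with hb | hb
    · obtain rfl := (Finsupp.degree_eq_zero_iff β).1 hb
      exact h0
    · obtain ⟨j, rfl⟩ := key β (by omega)
      by_cases hj : j = 0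
      · subst hj; exact h2
      · exact hm _ _ (by rw [(momentum_single j).2]; omega)
  · obtain ⟨j, rfl⟩ := key α (by omega)
    obtain rfl := (Finsupp.degree_eq_zero_iff β).1 (by omega)
    by_cases hj : j = 0
    · subst hj; exact h1
    · exact hm _ _ (by rw [(momentum_single j).1]; omega)

lemma exists_of_bracketTerm_ne_zero {F G : FormalSeries} {α β : MultiIndex} {j : ℤ}
    (h : bracketTerm F G α β j ≠ 0) :
    ∃ a b a' b' : MultiIndex, a + a' = α + single j 1 ∧ b + b' = β + single j 1 ∧
      F a b ≠ 0 ∧ G a' b' ≠ 0 ∧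
      (a j : ℂ) * (b' j : ℂ) - (b j : ℂ) * (a' j : ℂ) ≠ 0 := by
  obtain ⟨x, hx, h⟩ := Finset.exists_ne_zero_of_sum_ne_zero h
  obtain ⟨y, hy, h⟩ := Finset.exists_ne_zero_of_sum_ne_zero h
  rw [Finset.HasAntidiagonal.mem_antidiagonal] at hx hy
  refine ⟨x.1, y.1, x.2, y.2, hx, hy, ?_, ?_, ?_⟩ <;> intro h0 <;> simp [h0] at h

/-- The sum over `j` in the bracket of two formal Hamiltonians is finite. -/
lemma finite_support_bracketTerm {F G : FormalSeries} (hF : F ∈ formalHam)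
    (α β : MultiIndex) : (Function.support (bracketTerm F G α β)).Finite := by
  have hfin : ((Set.Icc 0 α) ×ˢ (Set.Icc 0 β)).Finite :=
    (Set.finite_Icc 0 α).prod (Set.finite_Icc 0 β)
  refine (((α.support ∪ β.support).finite_toSet.union
    (hfin.image fun p => momentum p.1 p.2)).union
    (hfin.image fun p => -momentum p.1 p.2)).subset fun j hj => ?_
  by_cases hs : j ∈ α.support ∪ β.support
  · exact Or.inl (Or.inl hs)
  obtain ⟨hα, hβ⟩ : α j = 0 ∧ β j = 0 := by simpa using hs
  obtain ⟨a, b, a', b', ha, hb, hFab, -, hne⟩ := exists_of_bracketTerm_ne_zero hj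
  have hm : momentum a b = 0 := by
    by_contra hm
    exact hFab (hF.2.2 a b hm)
  have haj : a j + a' j = 1 := by
    simpa [hα] using congrArg (fun f : MultiIndex => f j) ha
  have hbj : b j + b' j = 1 := by
    simpa [hβ] using congrArg (fun f : MultiIndex => f j) hb
  have le_of : ∀ c c' γ : MultiIndex, c + c' = γ + single j 1 → c j = 0 → c ≤ γ := by
    intro c c' γ h hc i
    have h1 : c i + c' i = γ i + single j 1 i :=
      by simpa using congrArg (fun f : MultiIndex => f i) h
    by_cases hi : i = j
    · subst hi; omega
    · rw [Finsupp.single_eq_of_ne hi] at h1; omega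
  have sub_of : ∀ c c' γ : MultiIndex, c + c' = γ + single j 1 → c j = 1 →
      ∃ e, c = e + single j 1 ∧ e ≤ γ := by
    intro c c' γ h hc
    have hle : single j 1 ≤ c := by
      rw [Finsupp.single_le_iff]; omega
    refine ⟨c - single j 1, (tsub_add_cancel_of_le hle).symm, ?_⟩
    rw [tsub_le_iff_right, ← h]
    exact le_self_add
  have hcase : (a j = 1 ∧ b j = 0) ∨ (a j = 0 ∧ b j = 1) := by
    rcases (by omega : a j = 0 ∨ a j = 1) with h1 | h1 <;>
      rcases (by omega : b j = 0 ∨ b j = 1) with h2 | h2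
    · exact absurd (by simp [h1, h2]) hne
    · exact Or.inr ⟨h1, h2⟩
    · exact Or.inl ⟨h1, h2⟩
    · exact absurd (by simp [h1, h2, (by omega : a' j = 0), (by omega : b' j = 0)]) hne
  rcases hcase with ⟨h1, h2⟩ | ⟨h1, h2⟩
  · obtain ⟨e, rfl, he⟩ := sub_of a a' α ha h1
    refine Or.inr ⟨(e, b), ⟨⟨zero_le, he⟩, ⟨zero_le, le_of b b' β hb h2⟩⟩, ?_⟩
    have := momentum_add e b (single j 1) 0
    rw [add_zero, hm, (momentum_single j).1] at this
    simp only
    omega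
  · obtain ⟨e, rfl, he⟩ := sub_of b b' β hb h2
    refine Or.inl (Or.inr ⟨(a, e), ⟨⟨zero_le, le_of a a' α ha h1⟩, ⟨zero_le, he⟩⟩, ?_⟩)
    have := momentum_add a e 0 (single j 1)
    rw [add_zero, hm, (momentum_single j).2] at this
    simp only
    omega

/-- `{𝓕^{≥ d}, 𝓕^{≥ e}} ⊆ 𝓕^{≥ d + e}`. -/
lemma bracket_mem_orderGE {F G : FormalSeries} {d e : ℕ} (hF : F ∈ orderGE d)
    (hG : G ∈ orderGE e) : bracket F G ∈ orderGE (d + e) := by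
  have hdeg : ∀ α β, α.degree + β.degree < d + e + 2 → bracket F G α β = 0 := by
    intro α β h
    rw [bracket, finsum_eq_zero_of_forall_eq_zero, mul_zero]
    intro j
    by_contra hj
    obtain ⟨a, b, a', b', ha, hb, hFab, hGab, -⟩ := exists_of_bracketTerm_ne_zero hj
    have h1 : ¬ a.degree + b.degree < d + 2 := fun h => hFab (hF.2 a b h)
    have h2 : ¬ a'.degree + b'.degree < e + 2 := fun h => hGab (hG.2 a' b' h)
    have h3 := congrArg Finsupp.degree ha
    have h4 := congrArg Finsupp.degree hb
    simp only [map_add, Finsupp.degree_single] at h3 h4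
    omega
  refine ⟨⟨⟨hdeg _ _ ?_, hdeg _ _ ?_, hdeg _ _ ?_⟩, fun α β => ?_, fun α β h => ?_⟩, hdeg⟩
  · simp
  · simp only [Finsupp.degree_single, map_zero]; omega
  · simp only [Finsupp.degree_single, map_zero]; omega
  · have hterm : ∀ j, (starRingEnd ℂ) (bracketTerm F G β α j) = - bracketTerm F G α β j := by
      intro j
      simp only [bracketTerm, map_sum, map_mul, map_sub, ← hF.1.2.1, ← hG.1.2.1, map_natCast]
      rw [Finset.sum_comm, ← Finset.sum_neg_distrib]
      refine Finset.sum_congr rfl fun x _ => ?_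
      rw [← Finset.sum_neg_distrib]
      refine Finset.sum_congr rfl fun y _ => ?_
      ring
    have hs : (starRingEnd ℂ) (∑ᶠ j, bracketTerm F G β α j) = - ∑ᶠ j, bracketTerm F G α β j := by
      rw [map_finsum _ (finite_support_bracketTerm hF.1 β α), ← finsum_neg_distrib]
      exact finsum_congr hterm
    simp only [bracket, map_mul, Complex.conj_I, hs]
    ring
  · rw [bracket, finsum_eq_zero_of_forall_eq_zero, mul_zero]
    intro j
    by_contra hj
    obtain ⟨a, b, a', b', ha, hb, hFab, hGab, -⟩ := exists_of_bracketTerm_ne_zero hj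
    have h1 : momentum a b = 0 := by
      by_contra hm
      exact hFab (hF.1.2.2 a b hm)
    have h2 : momentum a' b' = 0 := by
      by_contra hm
      exact hGab (hG.1.2.2 a' b' hm)
    have h3 := momentum_add a b a' b'
    rw [ha, hb, momentum_add, momentum_diag] at h3
    omega

lemma iterate_bracket_mem {G H : FormalSeries} {d e : ℕ} (hG : G ∈ orderGE d)
    (hH : H ∈ orderGE e) (k : ℕ) : (bracket G)^[k] H ∈ orderGE (k * d + e) := by
  induction k with
  | zero => simpa using hH
  | succ k ih =>
    rw [Function.iterate_succ_apply']
    have := bracket_mem_orderGE hG ih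
    rwa [show d + (k * d + e) = (k + 1) * d + e by ring] at this

/-- Each coefficient of `e^{{G,·}} H` is a finite sum when `G ∈ 𝓕^{≥ 1}` and `H ∈ 𝓕`. -/
lemma finite_support_expAd {G H : FormalSeries} (hG : G ∈ orderGE 1) (hH : H ∈ formalHam)
    (α β : MultiIndex) : (Function.support fun k : ℕ =>
      ((k.factorial : ℂ)⁻¹) * ((bracket G)^[k] H) α β).Finite := by
  refine (Set.finite_Iic (α.degree + β.degree)).subset fun k hk => ?_
  by_contra hlt
  have hlt : α.degree + β.degree < k := not_le.1 hlt
  refine hk ?_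
  simp only
  rw [(iterate_bracket_mem hG (mem_orderGE_zero hH) k).2 α β (by omega), mul_zero]

/-- `D_ω` is a formal Hamiltonian depending only on the actions. -/
lemma quadHam_mem (ω : ℤ → ℝ) : quadHam ω ∈ actionHam := by
  have hz : ∀ α β : MultiIndex, (∀ j, ¬ (α = single j 1 ∧ β = single j 1)) →
      quadHam ω α β = 0 := fun α β h =>
    finsum_eq_zero_of_forall_eq_zero fun j => if_neg (h j)
  have hne : ∀ j : ℤ, (0 : MultiIndex) ≠ single j 1 := fun j h => by
    simpa using (congrArg (fun f : MultiIndex => f j) h)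
  refine ⟨⟨⟨hz _ _ ?_, hz _ _ ?_, hz _ _ ?_⟩, fun α β => ?_, fun α β h => hz _ _ ?_⟩,
    fun α β h => hz _ _ ?_⟩
  · exact fun j h => hne j h.1
  · exact fun j h => hne j h.2
  · exact fun j h => hne j h.1
  · by_cases h : ∃ j, α = single j 1 ∧ β = single j 1
    · obtain ⟨j, rfl, rfl⟩ := h
      rw [quadHam, finsum_eq_single _ j]
      · simp
      · intro i hi
        rw [if_neg]
        rintro ⟨h, -⟩
        exact hi ((Finsupp.single_left_inj one_ne_zero).1 h).symm
    · push Not at h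
      rw [hz α β (fun j hj => h j hj.1 hj.2), hz β α (fun j hj => h j hj.2 hj.1), map_zero]
  · rintro j ⟨rfl, rfl⟩
    exact h (momentum_diag j)
  · rintro j ⟨rfl, rfl⟩
    exact h rfl

end FormalBirkhoff

/-!
The coefficient families are regarded as elements of the power series ring in `u` and `ū`, so that
`{F, ·}` becomes a derivation of the product and, by the Jacobi identity, of the bracket itself.
For `G` of order at least one, `e^{{G,·}}` is then an automorphism of both structures which is the
identity to leading order (`unipotentAut_formalExp`).

Existence. In the homogeneous expansion `S = S_d + S_{d+1} + ⋯` the component of degree `n` of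
`e^{{S,·}} H` is `{S_n, D_ω}` plus an expression in the earlier components. As `{·, D_ω}`
multiplies `u^α ū^β` by `i ω · (α - β)`, non-resonance allows `S_n` to remove all the off-diagonal
terms of degree `n` (`exists_improve`, `exists_normalizing`). Solving for the exponent itself,
rather than composing successive transformations, yields a single exponential at once.

Uniqueness. Let `K = e^{{S,·}} H` and `Φ K = e^{{G,·}} H` both be series in the actions, where
`Φ = e^{{G,·}} e^{{-S,·}}`. By non-resonance the centralizer of `Φ K` consists of series in the
actions (`mem_diagSeries_of_poisson_eq_zero`). Every series `Z` in the actions commutes with `K`,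
hence `Φ Z` commutes with `Φ K` and is again a series in the actions. Applying `Φ` to
`{Z, u_j} = -i (∂Z/∂I_j) u_j`, and comparing the monomials whose charge `α - β` is `e_j`, gives
`∂(Φ Z)/∂I_j = Φ (∂Z/∂I_j)` (`UnipotentAut.dAction_map`). Since `Φ` is the identity to leading
order, induction on the degree shows that `Φ` fixes all series in the actions, `K` among them
(`UnipotentAut.apply_diag`). The Baker–Campbell–Hausdorff formula is not needed.
-/

namespace FormalBirkhoff

open Finsupp (single)
open Finset.HasAntidiagonal (antidiagonal mem_antidiagonal)
open scoped Pointwise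

/-! ### The ring of formal power series and its derivations -/

/-- The ring of formal power series in the variables `u_j` and `ū_j`: power series in `u` whose
coefficients are power series in `ū`. As a type it unfolds to `FormalSeries`, but it carries
the Cauchy product, whereas multiplication on the function type `FormalSeries` is pointwise. -/
def PSeries : Type := MvPowerSeries ℤ (MvPowerSeries ℤ ℂ)

noncomputable instance : CommRing PSeries :=
  inferInstanceAs (CommRing (MvPowerSeries ℤ (MvPowerSeries ℤ ℂ)))

noncomputable instance : Algebra ℂ PSeries :=
  inferInstanceAs (Algebra ℂ (MvPowerSeries ℤ (MvPowerSeries ℤ ℂ)))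

instance : NoZeroDivisors PSeries :=
  inferInstanceAs (NoZeroDivisors (MvPowerSeries ℤ (MvPowerSeries ℤ ℂ)))

/-- A coefficient family, regarded as an element of the ring `PSeries`. -/
def ofCoef (φ : FormalSeries) : PSeries := φ

/-- The coefficient of `u^α ū^β`, as a linear functional. -/
noncomputable def coef (α β : MultiIndex) : PSeries →ₗ[ℂ] ℂ where
  toFun f := (f : FormalSeries) α β
  map_add' _ _ := rfl
  map_smul' _ _ := rfl

lemma coef_ofCoef (α β : MultiIndex) (φ : FormalSeries) : coef α β (ofCoef φ) = φ α β := rfl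

lemma PSeries.ext_coef {f g : PSeries} (h : ∀ α β, coef α β f = coef α β g) : f = g :=
  funext fun α => funext fun β => h α β

lemma coef_mul (α β : MultiIndex) (f g : PSeries) :
    coef α β (f * g) = ∑ x ∈ antidiagonal α, ∑ y ∈ antidiagonal β,
      coef x.1 y.1 f * coef x.2 y.2 g := by
  refine (congrArg (MvPowerSeries.coeff β) (MvPowerSeries.coeff_mul α f g)).trans ?_
  rw [map_sum]
  exact Finset.sum_congr rfl fun x _ => MvPowerSeries.coeff_mul _ _ _

lemma coef_one (α β : MultiIndex) :
    coef α β (1 : PSeries) = if α = 0 ∧ β = 0 then 1 else 0 := by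
  refine (congrArg (MvPowerSeries.coeff β)
    (MvPowerSeries.coeff_one (R := MvPowerSeries ℤ ℂ) (n := α))).trans ?_
  by_cases h : α = 0 <;> simp [h, MvPowerSeries.coeff_one]

lemma pderiv_mul {R : Type*} [CommRing R] (j : ℤ) (f g : MvPowerSeries ℤ R) :
    MvPowerSeries.pderiv R j (f * g) =
      f * MvPowerSeries.pderiv R j g + g * MvPowerSeries.pderiv R j f :=
  (MvPowerSeries.pderiv R j).leibniz f g

lemma coeff_pderiv_eq_nsmul {R : Type*} [CommRing R] (j : ℤ) (f : MvPowerSeries ℤ R)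
    (α : MultiIndex) : MvPowerSeries.coeff α (MvPowerSeries.pderiv R j f) =
      (α j + 1) • MvPowerSeries.coeff (α + single j 1) f := by
  rw [MvPowerSeries.coeff_pderiv, nsmul_eq_mul']
  push_cast
  rfl

/-- The derivation `∂/∂u_j`. -/
noncomputable def dU (j : ℤ) : Derivation ℂ PSeries PSeries :=
  Derivation.mk'
    { toFun := fun f => ofCoef fun α β => ((α j : ℂ) + 1) * coef (α + single j 1) β f
      map_add' := fun f g => PSeries.ext_coef fun α β => by
        simp only [map_add, coef_ofCoef, mul_add]
      map_smul' := fun c f => PSeries.ext_coef fun α β => by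
        simp only [map_smul, coef_ofCoef, smul_eq_mul, RingHom.id_apply]
        ring }
    (by
      have h : ∀ f : PSeries, ofCoef (fun α β => ((α j : ℂ) + 1) * coef (α + single j 1) β f) =
          MvPowerSeries.pderiv (MvPowerSeries ℤ ℂ) j f := fun f => PSeries.ext_coef fun α β => by
        refine Eq.trans ?_ (congrArg (MvPowerSeries.coeff β) (coeff_pderiv_eq_nsmul j f α)).symm
        rw [map_nsmul, nsmul_eq_mul, Nat.cast_add_one]
        rfl
      intro f g
      refine (h (f * g)).trans ((pderiv_mul j f g).trans ?_)
      exact congrArg₂ (fun x y : PSeries => f * x + g * y) (h g).symm (h f).symm)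

/-- The derivation `∂/∂ū_j`. -/
noncomputable def dUbar (j : ℤ) : Derivation ℂ PSeries PSeries :=
  Derivation.mk'
    { toFun := fun f => ofCoef fun α β => ((β j : ℂ) + 1) * coef α (β + single j 1) f
      map_add' := fun f g => PSeries.ext_coef fun α β => by
        simp only [map_add, coef_ofCoef, mul_add]
      map_smul' := fun c f => PSeries.ext_coef fun α β => by
        simp only [map_smul, coef_ofCoef, smul_eq_mul, RingHom.id_apply]
        ring }
    (by
      have h : ∀ (f : PSeries) (α : MultiIndex),
          (ofCoef (fun α β => ((β j : ℂ) + 1) * coef α (β + single j 1) f) : FormalSeries) α =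
          MvPowerSeries.pderiv ℂ j (MvPowerSeries.coeff α f) := fun f α => by
        refine MvPowerSeries.ext fun β => ?_
        rw [MvPowerSeries.coeff_pderiv, mul_comm]
        rfl
      intro f g
      refine funext fun α => ?_
      refine (h (f * g) α).trans ?_
      have h1 : MvPowerSeries.coeff α (f * g : PSeries) = _ := MvPowerSeries.coeff_mul α f g
      rw [h1, map_sum]
      refine Eq.trans ?_ (congrArg₂ (· + ·) (MvPowerSeries.coeff_mul α f _)
        ((congrArg (MvPowerSeries.coeff α) (mul_comm g _)).trans
          (MvPowerSeries.coeff_mul α _ g))).symm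
      rw [← Finset.sum_add_distrib]
      refine Finset.sum_congr rfl fun x _ => ?_
      rw [Derivation.leibniz, smul_eq_mul, smul_eq_mul, mul_comm (MvPowerSeries.coeff x.2 g),
        ← h f, ← h g]
      rfl)

lemma coef_dU (j : ℤ) (α β : MultiIndex) (f : PSeries) :
    coef α β (dU j f) = ((α j : ℂ) + 1) * coef (α + single j 1) β f := rfl

lemma coef_dUbar (j : ℤ) (α β : MultiIndex) (f : PSeries) :
    coef α β (dUbar j f) = ((β j : ℂ) + 1) * coef α (β + single j 1) f := rfl

lemma dU_dU (i j : ℤ) (f : PSeries) : dU i (dU j f) = dU j (dU i f) := by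
  refine PSeries.ext_coef fun α β => ?_
  by_cases h : i = j
  · rw [h]
  · simp only [coef_dU, Finsupp.add_apply, Finsupp.single_eq_of_ne h,
      Finsupp.single_eq_of_ne (Ne.symm h)]
    rw [add_right_comm α (single i 1), mul_left_comm]
    simp only [add_zero]

lemma dUbar_dUbar (i j : ℤ) (f : PSeries) : dUbar i (dUbar j f) = dUbar j (dUbar i f) := by
  refine PSeries.ext_coef fun α β => ?_
  by_cases h : i = j
  · rw [h]
  · simp only [coef_dUbar, Finsupp.add_apply, Finsupp.single_eq_of_ne h,
      Finsupp.single_eq_of_ne (Ne.symm h)]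
    rw [add_right_comm β (single i 1), mul_left_comm]
    simp only [add_zero]

lemma dU_dUbar (i j : ℤ) (f : PSeries) : dU i (dUbar j f) = dUbar j (dU i f) := by
  refine PSeries.ext_coef fun α β => ?_
  simp only [coef_dU, coef_dUbar]
  ring

/-- The contribution `∂_{u_j} F ∂_{ū_j} G - ∂_{ū_j} F ∂_{u_j} G` of the mode `j` to `-i {F, G}`. -/
noncomputable def modeBracket (j : ℤ) (F G : PSeries) : PSeries :=
  dU j F * dUbar j G - dUbar j F * dU j G

/-- Shifting the index turns the factor `x.1 j` into a derivative of the first factor of a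
product. -/
lemma sum_antidiagonal_add_single (j : ℤ) (α : MultiIndex) (φ : MultiIndex → MultiIndex → ℂ) :
    ∑ x ∈ antidiagonal (α + single j 1), ((x.1 : MultiIndex) j : ℂ) * φ x.1 x.2 =
      ∑ x ∈ antidiagonal α, (((x.1 : MultiIndex) j : ℂ) + 1) * φ (x.1 + single j 1) x.2 := by
  symm
  refine Finset.sum_of_injOn (fun x => (x.1 + single j 1, x.2)) ?_ ?_ ?_ ?_
  · rintro ⟨a, b⟩ - ⟨c, d⟩ - h
    simpa using h
  · intro x hx
    simp only [Finset.mem_coe, mem_antidiagonal] at hx ⊢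
    rw [← hx, add_right_comm]
  · rintro ⟨a, b⟩ hx hne
    rw [mem_antidiagonal] at hx
    by_cases h0 : a j = 0
    · simp [h0]
    refine absurd ?_ hne
    have hle : single j 1 ≤ a := by
      rw [Finsupp.single_le_iff]; omega
    refine ⟨(a - single j 1, b), ?_, ?_⟩
    · simp only [Finset.mem_coe, mem_antidiagonal]
      refine add_right_cancel (b := single j 1) ?_
      rw [← hx, add_right_comm, tsub_add_cancel_of_le hle]
    · simp [tsub_add_cancel_of_le hle]
  · intro x _
    simp

lemma sum_antidiagonal_add_single' (j : ℤ) (α : MultiIndex) (φ : MultiIndex → MultiIndex → ℂ) :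
    ∑ x ∈ antidiagonal (α + single j 1), ((x.2 : MultiIndex) j : ℂ) * φ x.1 x.2 =
      ∑ x ∈ antidiagonal α, (((x.2 : MultiIndex) j : ℂ) + 1) * φ x.1 (x.2 + single j 1) := by
  refine (Finsupp.sum_antidiagonal_swap _ fun a b => ((b : MultiIndex) j : ℂ) * φ a b).trans
    ((sum_antidiagonal_add_single j α fun a b => φ b a).trans ?_)
  exact (Finsupp.sum_antidiagonal_swap α fun a b =>
    (((b : MultiIndex) j : ℂ) + 1) * φ a (b + single j 1)).symm

lemma bracketTerm_eq_coef (F G : PSeries) (α β : MultiIndex) (j : ℤ) :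
    bracketTerm F G α β j = coef α β (modeBracket j F G) := by
  have h1 : bracketTerm F G α β j =
      (∑ x ∈ antidiagonal (α + single j 1), ((x.1 : MultiIndex) j : ℂ) *
        ∑ y ∈ antidiagonal (β + single j 1), ((y.2 : MultiIndex) j : ℂ) *
          (coef x.1 y.1 F * coef x.2 y.2 G)) -
      ∑ x ∈ antidiagonal (α + single j 1), ((x.2 : MultiIndex) j : ℂ) *
        ∑ y ∈ antidiagonal (β + single j 1), ((y.1 : MultiIndex) j : ℂ) *
          (coef x.1 y.1 F * coef x.2 y.2 G) := by
    simp only [bracketTerm, Finset.mul_sum, ← Finset.sum_sub_distrib]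
    refine Finset.sum_congr rfl fun x _ => Finset.sum_congr rfl fun y _ => ?_
    change coef x.1 y.1 F * coef x.2 y.2 G * _ = _
    ring
  rw [h1, modeBracket, map_sub, coef_mul, coef_mul,
    sum_antidiagonal_add_single j α fun a b => ∑ y ∈ antidiagonal (β + single j 1),
      ((y.2 : MultiIndex) j : ℂ) * (coef a y.1 F * coef b y.2 G),
    sum_antidiagonal_add_single' j α fun a b => ∑ y ∈ antidiagonal (β + single j 1),
      ((y.1 : MultiIndex) j : ℂ) * (coef a y.1 F * coef b y.2 G)]
  congr 1
  · refine Finset.sum_congr rfl fun x _ => ?_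
    rw [sum_antidiagonal_add_single' j β fun c d =>
      coef (x.1 + single j 1) c F * coef x.2 d G, Finset.mul_sum]
    refine Finset.sum_congr rfl fun y _ => ?_
    rw [coef_dU, coef_dUbar]
    ring
  · refine Finset.sum_congr rfl fun x _ => ?_
    rw [sum_antidiagonal_add_single j β fun c d =>
      coef x.1 c F * coef (x.2 + single j 1) d G, Finset.mul_sum]
    refine Finset.sum_congr rfl fun y _ => ?_
    rw [coef_dU, coef_dUbar]
    ring

/-! ### Charge of a monomial -/

/-- The charge `α - β ∈ ℤ_f^ℤ` of the monomial `u^α ū^β`. It is additive under products and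
brackets, and the momentum depends on it alone. -/
noncomputable def charge (α β : MultiIndex) : ℤ →₀ ℤ :=
  α.mapRange (fun n : ℕ => (n : ℤ)) rfl - β.mapRange (fun n : ℕ => (n : ℤ)) rfl

lemma charge_apply (α β : MultiIndex) (i : ℤ) : charge α β i = (α i : ℤ) - (β i : ℤ) := rfl

lemma charge_add (α β α' β' : MultiIndex) :
    charge (α + α') (β + β') = charge α β + charge α' β' := by
  ext i
  simp only [charge_apply, Finsupp.add_apply]
  push_cast
  ring

lemma charge_eq_zero {α β : MultiIndex} : charge α β = 0 ↔ α = β := by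
  refine ⟨fun h => ?_, ?_⟩
  · ext i
    have := DFunLike.congr_fun h i
    rw [charge_apply, Finsupp.zero_apply] at this
    omega
  · rintro rfl
    exact sub_self _

/-- The momentum `∑_j j l_j` as a function of the charge `l`. -/
noncomputable def chargeMomentum : (ℤ →₀ ℤ) →+ ℤ :=
  Finsupp.liftAddHom fun j => AddMonoidHom.mulLeft j

lemma momentum_eq (α β : MultiIndex) : momentum α β = chargeMomentum (charge α β) := by
  rw [charge, map_sub, momentum]
  simp only [chargeMomentum, Finsupp.liftAddHom_apply]
  rw [Finsupp.sum_mapRange_index (by simp), Finsupp.sum_mapRange_index (by simp)]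
  rfl

/-- The series all of whose monomials have charge in `T`. -/
def chargeIn (T : Set (ℤ →₀ ℤ)) : Submodule ℂ PSeries where
  carrier := {f | ∀ α β, charge α β ∉ T → coef α β f = 0}
  zero_mem' := by simp
  add_mem' := fun hf hg α β h => by simp [hf α β h, hg α β h]
  smul_mem' := fun c f hf α β h => by simp [hf α β h]

lemma chargeIn_mono {S T : Set (ℤ →₀ ℤ)} (h : S ⊆ T) : chargeIn S ≤ chargeIn T :=
  fun _ hf α β hT => hf α β fun hS => hT (h hS)

lemma mul_mem_chargeIn {S T : Set (ℤ →₀ ℤ)} {f g : PSeries} (hf : f ∈ chargeIn S)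
    (hg : g ∈ chargeIn T) : f * g ∈ chargeIn (S + T) := by
  intro α β h
  rw [coef_mul]
  refine Finset.sum_eq_zero fun x hx => Finset.sum_eq_zero fun y hy => ?_
  rw [mem_antidiagonal] at hx hy
  by_contra hne
  refine h ?_
  rw [← hx, ← hy, charge_add]
  refine Set.add_mem_add ?_ ?_
  · by_contra hS
    exact hne (by rw [hf _ _ hS, zero_mul])
  · by_contra hS
    exact hne (by rw [hg _ _ hS, mul_zero])

/-- The series in the actions `|u_j|²`, with arbitrary complex coefficients and constant term. -/
abbrev diagSeries : Submodule ℂ PSeries := chargeIn {0}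

lemma mem_diagSeries {f : PSeries} : f ∈ diagSeries ↔ ∀ α β, α ≠ β → coef α β f = 0 := by
  refine forall₂_congr fun α β => ?_
  rw [Set.mem_singleton_iff, charge_eq_zero]

/-- The momentum-conserving series. With a first argument of this kind each coefficient of the
bracket is a finite sum, whatever the second argument. -/
abbrev momentumZero : Submodule ℂ PSeries := chargeIn {l | chargeMomentum l = 0}

lemma diag_le_momentumZero : diagSeries ≤ momentumZero :=
  chargeIn_mono (by simp)

/-! ### Filtration by degree -/

/-- The series all of whose monomials have degree `|α| + |β| ≥ n`. The index is the degree itself,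
so `𝓕^{≥ d}` lies in `ordGE (d + 2)`. -/
def ordGE (n : ℕ) : Submodule ℂ PSeries where
  carrier := {f | ∀ α β, α.degree + β.degree < n → coef α β f = 0}
  zero_mem' := by simp
  add_mem' := fun hf hg α β h => by simp [hf α β h, hg α β h]
  smul_mem' := fun c f hf α β h => by simp [hf α β h]

lemma ordGE_anti {m n : ℕ} (h : m ≤ n) : ordGE n ≤ ordGE m :=
  fun _ hf α β hm => hf α β (hm.trans_le h)

lemma mem_ordGE_zero (f : PSeries) : f ∈ ordGE 0 := fun _ _ h => absurd h (by simp)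

lemma eq_of_sub_mem_ordGE {f g : PSeries} (h : ∀ n, f - g ∈ ordGE n) : f = g :=
  PSeries.ext_coef fun α β => by
    have := h _ α β (Nat.lt_succ_self _)
    rwa [map_sub, sub_eq_zero] at this

lemma mul_mem_ordGE {m n : ℕ} {f g : PSeries} (hf : f ∈ ordGE m) (hg : g ∈ ordGE n) :
    f * g ∈ ordGE (m + n) := by
  intro α β h
  rw [coef_mul]
  refine Finset.sum_eq_zero fun x hx => Finset.sum_eq_zero fun y hy => ?_
  rw [mem_antidiagonal] at hx hy
  by_cases h1 : x.1.degree + y.1.degree < m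
  · rw [hf _ _ h1, zero_mul]
  · rw [hg _ _ ?_, mul_zero]
    rw [← hx, ← hy, map_add, map_add] at h
    omega

/-! ### The Poisson bracket as a bilinear map -/

/-- A finite set of modes outside which no mode contributes to the coefficients of `{F, G}` at
indices below `(α, β)`, for any momentum-conserving `F` and any `G`. It does not depend on `F`
and `G`. -/
noncomputable def relevantModes (α β : MultiIndex) : Finset ℤ :=
  ((Set.finite_Icc 0 α).toFinset ×ˢ (Set.finite_Icc 0 β).toFinset).image
      (fun p => momentum p.1 p.2) ∪
    ((Set.finite_Icc 0 α).toFinset ×ˢ (Set.finite_Icc 0 β).toFinset).image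
      (fun p => -momentum p.1 p.2)

/-- Momentum conservation makes `∂F/∂u_j` a series of momentum `-j`, and `∂F/∂ū_j` one of momentum
`j`; the monomials below `u^α ū^β` have only finitely many momenta. -/
lemma coef_d_eq_zero {F : PSeries} (hF : F ∈ momentumZero) {α β a b : MultiIndex}
    (ha : a ≤ α) (hb : b ≤ β) {j : ℤ} (hj : j ∉ relevantModes α β) :
    coef a b (dU j F) = 0 ∧ coef a b (dUbar j F) = 0 := by
  simp only [relevantModes, Finset.mem_union, Finset.mem_image, Finset.mem_product,
    Set.Finite.mem_toFinset, Set.mem_Icc, Prod.exists, not_or, not_exists, not_and] at hj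
  have h1 := hj.1 a b ⟨⟨zero_le, ha⟩, ⟨zero_le, hb⟩⟩
  have h2 := hj.2 a b ⟨⟨zero_le, ha⟩, ⟨zero_le, hb⟩⟩
  have e1 := momentum_add a b (single j 1) 0
  have e2 := momentum_add a b 0 (single j 1)
  rw [(momentum_single j).1, add_zero] at e1
  rw [(momentum_single j).2, add_zero] at e2
  rw [coef_dU, coef_dUbar]
  constructor
  · rw [hF _ _ ?_, mul_zero]
    rw [Set.mem_ofPred_eq, ← momentum_eq, e1]
    omega
  · rw [hF _ _ ?_, mul_zero]
    rw [Set.mem_ofPred_eq, ← momentum_eq, e2]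
    omega

lemma coef_modeBracket_eq_zero {F : PSeries} (hF : F ∈ momentumZero) (G : PSeries)
    {α β a b : MultiIndex} (ha : a ≤ α) (hb : b ≤ β) {j : ℤ} (hj : j ∉ relevantModes α β) :
    coef a b (modeBracket j F G) = 0 := by
  rw [modeBracket, map_sub, coef_mul, coef_mul, ← Finset.sum_sub_distrib]
  refine Finset.sum_eq_zero fun x hx => ?_
  rw [← Finset.sum_sub_distrib]
  refine Finset.sum_eq_zero fun y hy => ?_
  have hx' := (le_self_add.trans_eq (mem_antidiagonal.1 hx)).trans ha
  have hy' := (le_self_add.trans_eq (mem_antidiagonal.1 hy)).trans hb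
  have := coef_d_eq_zero hF hx' hy' hj
  rw [this.1, this.2, zero_mul, zero_mul, sub_zero]

/-- The Poisson bracket restricted to a finite set `J` of modes. -/
noncomputable def finBracket (J : Finset ℤ) (F G : PSeries) : PSeries :=
  Complex.I • ∑ j ∈ J, modeBracket j F G

lemma finBracket_add_left (J : Finset ℤ) (F F' G : PSeries) :
    finBracket J (F + F') G = finBracket J F G + finBracket J F' G := by
  simp only [finBracket, ← smul_add, ← Finset.sum_add_distrib]
  congr 1
  refine Finset.sum_congr rfl fun j _ => ?_
  simp only [modeBracket, map_add]
  ring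

lemma finBracket_smul_left (J : Finset ℤ) (c : ℂ) (F G : PSeries) :
    finBracket J (c • F) G = c • finBracket J F G := by
  simp only [finBracket, modeBracket, Derivation.map_smul, smul_mul_assoc, ← smul_sub,
    ← Finset.smul_sum]
  rw [smul_comm]

lemma finBracket_antisymm (J : Finset ℤ) (F G : PSeries) :
    finBracket J F G = -finBracket J G F := by
  simp only [finBracket, ← smul_neg, ← Finset.sum_neg_distrib]
  congr 1
  refine Finset.sum_congr rfl fun j _ => ?_
  rw [modeBracket, modeBracket]
  ring

/-- The Poisson bracket as a bilinear map on all series: the coefficient of `u^α ū^β` only sums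
over `relevantModes α β`. This total version agrees with `bracket` when the first argument
conserves momentum, see `bracket_eq_poisson`. -/
noncomputable def poisson : PSeries →ₗ[ℂ] PSeries →ₗ[ℂ] PSeries :=
  LinearMap.mk₂ ℂ (fun F G => ofCoef fun α β => coef α β (finBracket (relevantModes α β) F G))
    (fun F F' G => PSeries.ext_coef fun α β => by
      simp only [map_add, coef_ofCoef, finBracket_add_left])
    (fun c F G => PSeries.ext_coef fun α β => by
      simp only [map_smul, coef_ofCoef, finBracket_smul_left])
    (fun F G G' => PSeries.ext_coef fun α β => by
      simp only [map_add, coef_ofCoef, finBracket_antisymm _ F, finBracket_add_left, map_neg,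
        neg_add])
    (fun c F G => PSeries.ext_coef fun α β => by
      simp only [map_smul, coef_ofCoef, finBracket_antisymm _ F, finBracket_smul_left, map_neg,
        smul_neg])

lemma coef_poisson (F G : PSeries) (α β : MultiIndex) :
    coef α β (poisson F G) = coef α β (finBracket (relevantModes α β) F G) := rfl

/-- All coefficients of `{F, G}` below `(α, β)` may be computed with one and the same finite set
of modes. -/
lemma coef_poisson_eq {F : PSeries} (hF : F ∈ momentumZero) (G : PSeries)
    {α β a b : MultiIndex} (ha : a ≤ α) (hb : b ≤ β) {J : Finset ℤ} (hJ : relevantModes α β ⊆ J) :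
    coef a b (poisson F G) = coef a b (finBracket J F G) := by
  have key : ∀ {α' β' : MultiIndex} {J' : Finset ℤ}, relevantModes α' β' ⊆ J' → a ≤ α' → b ≤ β' →
      coef a b (finBracket (relevantModes α' β') F G) = coef a b (finBracket J' F G) := by
    intro α' β' J' h h1 h2
    simp only [finBracket, map_smul, map_sum]
    congr 1
    exact Finset.sum_subset h fun j _ hj => coef_modeBracket_eq_zero hF G h1 h2 hj
  rw [coef_poisson, key (J' := relevantModes a b ∪ J) Finset.subset_union_left le_rfl le_rfl,
    ← key (hJ.trans Finset.subset_union_right) ha hb, key hJ ha hb]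

lemma poisson_antisymm (F G : PSeries) : poisson F G = -poisson G F := by
  refine PSeries.ext_coef fun α β => ?_
  rw [map_neg, coef_poisson, coef_poisson, ← map_neg, ← finBracket_antisymm]

lemma bracket_eq_poisson {F : PSeries} (hF : F ∈ momentumZero) (G : PSeries) :
    bracket F G = poisson F G := by
  refine PSeries.ext_coef fun α β => ?_
  rw [coef_poisson, finBracket, map_smul, map_sum, smul_eq_mul]
  change Complex.I * _ = _
  simp only [bracketTerm_eq_coef]
  congr 1
  refine finsum_eq_sum_of_support_subset _ fun j hj => ?_
  by_contra h
  exact hj (coef_modeBracket_eq_zero hF G le_rfl le_rfl h)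

lemma exists_of_coef_finBracket_ne_zero {J : Finset ℤ} {F G : PSeries} {α β : MultiIndex}
    (h : coef α β (finBracket J F G) ≠ 0) :
    ∃ j, ∃ a b a' b' : MultiIndex, a + a' = α + single j 1 ∧ b + b' = β + single j 1 ∧
      coef a b F ≠ 0 ∧ coef a' b' G ≠ 0 ∧
      (a j : ℂ) * (b' j : ℂ) - (b j : ℂ) * (a' j : ℂ) ≠ 0 := by
  rw [finBracket, map_smul, map_sum, smul_eq_mul] at h
  obtain ⟨j, -, hj⟩ := Finset.exists_ne_zero_of_sum_ne_zero (right_ne_zero_of_mul h)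
  rw [← bracketTerm_eq_coef] at hj
  exact ⟨j, exists_of_bracketTerm_ne_zero hj⟩

lemma charge_split {a b a' b' α β : MultiIndex} {j : ℤ} (h1 : a + a' = α + single j 1)
    (h2 : b + b' = β + single j 1) : charge a b + charge a' b' = charge α β := by
  rw [← charge_add, h1, h2, charge_add, charge_eq_zero.2 rfl, add_zero]

lemma finBracket_mem_chargeIn (J : Finset ℤ) {S T : Set (ℤ →₀ ℤ)} {F G : PSeries}
    (hF : F ∈ chargeIn S) (hG : G ∈ chargeIn T) : finBracket J F G ∈ chargeIn (S + T) := by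
  intro α β h
  by_contra hne
  obtain ⟨j, a, b, a', b', h1, h2, h3, h4, -⟩ := exists_of_coef_finBracket_ne_zero hne
  refine h ?_
  rw [← charge_split h1 h2]
  exact Set.add_mem_add (by_contra fun hS => h3 (hF _ _ hS)) (by_contra fun hS => h4 (hG _ _ hS))

lemma poisson_mem_chargeIn {S T : Set (ℤ →₀ ℤ)} {F G : PSeries}
    (hF : F ∈ chargeIn S) (hG : G ∈ chargeIn T) : poisson F G ∈ chargeIn (S + T) :=
  fun α β h => finBracket_mem_chargeIn _ hF hG α β h

lemma finBracket_mem_momentumZero (J : Finset ℤ) {F G : PSeries} (hF : F ∈ momentumZero)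
    (hG : G ∈ momentumZero) : finBracket J F G ∈ momentumZero := by
  refine chargeIn_mono ?_ (finBracket_mem_chargeIn J hF hG)
  rintro _ ⟨x, hx, y, hy, rfl⟩
  rw [Set.mem_ofPred_eq] at hx hy ⊢
  simp [hx, hy]

lemma poisson_mem_momentumZero {F G : PSeries} (hF : F ∈ momentumZero)
    (hG : G ∈ momentumZero) : poisson F G ∈ momentumZero :=
  fun α β h => finBracket_mem_momentumZero _ hF hG α β h

lemma poisson_mem_ordGE {m n : ℕ} {F G : PSeries} (hF : F ∈ ordGE m) (hG : G ∈ ordGE n) :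
    poisson F G ∈ ordGE (m + n - 2) := by
  intro α β h
  by_contra hne
  obtain ⟨j, a, b, a', b', h1, h2, h3, h4, -⟩ := exists_of_coef_finBracket_ne_zero hne
  have e1 : ¬ a.degree + b.degree < m := fun h => h3 (hF _ _ h)
  have e2 : ¬ a'.degree + b'.degree < n := fun h => h4 (hG _ _ h)
  have h5 := congrArg Finsupp.degree h1
  have h6 := congrArg Finsupp.degree h2
  simp only [map_add, Finsupp.degree_single] at h5 h6
  omega

lemma poisson_diag {F G : PSeries} (hF : F ∈ diagSeries) (hG : G ∈ diagSeries) :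
    poisson F G = 0 := by
  refine PSeries.ext_coef fun α β => ?_
  rw [map_zero]
  by_contra hne
  obtain ⟨j, a, b, a', b', h1, h2, h3, h4, h5⟩ := exists_of_coef_finBracket_ne_zero hne
  have e1 : a = b := by_contra fun h => h3 (mem_diagSeries.1 hF _ _ h)
  have e2 : a' = b' := by_contra fun h => h4 (mem_diagSeries.1 hG _ _ h)
  exact h5 (by rw [e1, e2, sub_self])

lemma coef_mul_congr {f f' g g' : PSeries} {α β : MultiIndex}
    (hf : ∀ a ≤ α, ∀ b ≤ β, coef a b f = coef a b f')
    (hg : ∀ a ≤ α, ∀ b ≤ β, coef a b g = coef a b g') :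
    coef α β (f * g) = coef α β (f' * g') := by
  rw [coef_mul, coef_mul]
  refine Finset.sum_congr rfl fun x hx => Finset.sum_congr rfl fun y hy => ?_
  rw [mem_antidiagonal] at hx hy
  rw [hf _ (le_self_add.trans_eq hx) _ (le_self_add.trans_eq hy),
    hg _ (le_add_self.trans_eq hx) _ (le_add_self.trans_eq hy)]

lemma finBracket_leibniz (J : Finset ℤ) (F G H : PSeries) :
    finBracket J F (G * H) = finBracket J F G * H + G * finBracket J F H := by
  simp only [finBracket, smul_mul_assoc, mul_smul_comm, ← smul_add, Finset.sum_mul, Finset.mul_sum,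
    ← Finset.sum_add_distrib]
  congr 1
  refine Finset.sum_congr rfl fun j _ => ?_
  simp only [modeBracket, Derivation.leibniz, smul_eq_mul]
  ring

lemma poisson_leibniz {F : PSeries} (hF : F ∈ momentumZero) (G H : PSeries) :
    poisson F (G * H) = poisson F G * H + G * poisson F H := by
  refine PSeries.ext_coef fun α β => ?_
  have h : ∀ G : PSeries, ∀ a ≤ α, ∀ b ≤ β,
      coef a b (poisson F G) = coef a b (finBracket (relevantModes α β) F G) := fun G a ha b hb =>
    coef_poisson_eq hF G ha hb subset_rfl
  rw [h _ _ le_rfl _ le_rfl, finBracket_leibniz, map_add, map_add,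
    coef_mul_congr (h G) fun _ _ _ _ => rfl, coef_mul_congr (fun _ _ _ _ => rfl) (h H)]

lemma dU_finBracket (J : Finset ℤ) (i : ℤ) (F G : PSeries) :
    dU i (finBracket J F G) = finBracket J (dU i F) G + finBracket J F (dU i G) := by
  simp only [finBracket, Derivation.map_smul, map_sum, ← smul_add, ← Finset.sum_add_distrib]
  congr 1
  refine Finset.sum_congr rfl fun j _ => ?_
  simp only [modeBracket, map_sub, Derivation.leibniz, smul_eq_mul, dU_dU i j, dU_dUbar]
  ring

lemma dUbar_finBracket (J : Finset ℤ) (i : ℤ) (F G : PSeries) :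
    dUbar i (finBracket J F G) = finBracket J (dUbar i F) G + finBracket J F (dUbar i G) := by
  simp only [finBracket, Derivation.map_smul, map_sum, ← smul_add, ← Finset.sum_add_distrib]
  congr 1
  refine Finset.sum_congr rfl fun j _ => ?_
  simp only [modeBracket, map_sub, Derivation.leibniz, smul_eq_mul, dUbar_dUbar i j, dU_dUbar]
  ring

/-- For finitely many modes the Jacobi identity is an identity in a commutative ring with
commuting derivations. -/
lemma finBracket_jacobi (J : Finset ℤ) (F G H : PSeries) :
    finBracket J F (finBracket J G H) =
      finBracket J (finBracket J F G) H + finBracket J G (finBracket J F H) := by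
  have h0 : ∀ A B : PSeries, finBracket J A B =
      Complex.I • ∑ i ∈ J, (dU i A * dUbar i B - dUbar i A * dU i B) := fun _ _ => rfl
  rw [h0 F (finBracket J G H), h0 (finBracket J F G), h0 G (finBracket J F H)]
  simp only [dU_finBracket, dUbar_finBracket]
  simp only [finBracket, ← smul_add, mul_smul_comm, smul_mul_assoc, ← smul_sub, ← Finset.smul_sum]
  congr 2
  simp only [← Finset.sum_add_distrib, Finset.mul_sum, Finset.sum_mul, ← Finset.sum_sub_distrib]
  -- the terms match after exchanging `i` and `j` in the second sum and in half of the third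
  have e2 := Finset.sum_comm (s := J) (t := J) (f := fun i j =>
    (modeBracket j (dU i F) G + modeBracket j F (dU i G)) * dUbar i H -
      (modeBracket j (dUbar i F) G + modeBracket j F (dUbar i G)) * dU i H)
  have e3 : ∑ i ∈ J, ∑ j ∈ J,
      (dU i G * (modeBracket j (dUbar i F) H + modeBracket j F (dUbar i H)) -
        dUbar i G * (modeBracket j (dU i F) H + modeBracket j F (dU i H))) =
      ∑ i ∈ J, ∑ j ∈ J,
        (dU i G * modeBracket j (dUbar i F) H - dUbar i G * modeBracket j (dU i F) H) +
      ∑ i ∈ J, ∑ j ∈ J,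
        (dU j G * modeBracket i F (dUbar j H) - dUbar j G * modeBracket i F (dU j H)) := by
    rw [Finset.sum_comm (f := fun i j =>
      dU j G * modeBracket i F (dUbar j H) - dUbar j G * modeBracket i F (dU j H))]
    simp only [← Finset.sum_add_distrib]
    refine Finset.sum_congr rfl fun i _ => Finset.sum_congr rfl fun j _ => ?_
    ring
  refine Eq.trans ?_ ((congrArg₂ (· + ·) e2 e3).symm.trans (by
    simp only [← Finset.sum_add_distrib]))
  simp only [← Finset.sum_add_distrib]
  refine Finset.sum_congr rfl fun i _ => Finset.sum_congr rfl fun j _ => ?_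
  simp only [modeBracket, dU_dUbar]
  rw [dU_dU j i F, dU_dU j i G, dU_dU j i H, dUbar_dUbar j i F, dUbar_dUbar j i G,
    dUbar_dUbar j i H]
  ring

lemma coef_finBracket_congr {J : Finset ℤ} {F F' G G' : PSeries} {α β : MultiIndex}
    (hF : ∀ a ≤ α + ∑ j ∈ J, single j 1, ∀ b ≤ β + ∑ j ∈ J, single j 1, coef a b F = coef a b F')
    (hG : ∀ a ≤ α + ∑ j ∈ J, single j 1, ∀ b ≤ β + ∑ j ∈ J, single j 1, coef a b G = coef a b G') :
    coef α β (finBracket J F G) = coef α β (finBracket J F' G') := by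
  simp only [finBracket, map_smul, map_sum]
  congr 1
  refine Finset.sum_congr rfl fun j hj => ?_
  have hle : (single j 1 : MultiIndex) ≤ ∑ j ∈ J, single j 1 :=
    Finset.single_le_sum_of_canonicallyOrdered (f := fun j => (single j 1 : MultiIndex)) hj
  have h1 : ∀ {X X' : PSeries}, (∀ a ≤ α + ∑ j ∈ J, single j 1, ∀ b ≤ β + ∑ j ∈ J, single j 1,
      coef a b X = coef a b X') → (∀ a ≤ α, ∀ b ≤ β, coef a b (dU j X) = coef a b (dU j X')) ∧
        ∀ a ≤ α, ∀ b ≤ β, coef a b (dUbar j X) = coef a b (dUbar j X') := by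
    intro X X' h
    constructor <;> intro a ha b hb
    · rw [coef_dU, coef_dU, h _ (add_le_add ha hle) _ (hb.trans le_self_add)]
    · rw [coef_dUbar, coef_dUbar, h _ (ha.trans le_self_add) _ (add_le_add hb hle)]
  rw [modeBracket, modeBracket, map_sub, map_sub, coef_mul_congr (h1 hF).1 (h1 hG).2,
    coef_mul_congr (h1 hF).2 (h1 hG).1]

/-- The Jacobi identity, deduced coefficientwise from the case of finitely many modes: the outer
bracket involves finitely many modes, and these require only finitely many coefficients of the
inner bracket. -/
lemma poisson_jacobi {F G : PSeries} (hF : F ∈ momentumZero) (hG : G ∈ momentumZero)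
    (H : PSeries) :
    poisson F (poisson G H) = poisson (poisson F G) H + poisson G (poisson F H) := by
  refine PSeries.ext_coef fun α β => ?_
  set J₀ := relevantModes α β with hJ₀
  -- the coefficients below `(α', β')` are those that the outer bracket over `J₀` can reach
  set α' := α + ∑ j ∈ J₀, single j 1
  set β' := β + ∑ j ∈ J₀, single j 1
  set J := J₀ ∪ relevantModes α' β'
  have hJ : J₀ ⊆ J := Finset.subset_union_left
  have hJ' : relevantModes α' β' ⊆ J := Finset.subset_union_right
  have swap : ∀ {X : PSeries} (Y : PSeries), X ∈ momentumZero →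
      coef α β (finBracket J₀ X Y) = coef α β (finBracket J X Y) := fun Y hX => by
    rw [← coef_poisson_eq hX Y le_rfl le_rfl hJ, coef_poisson]
  have inner : ∀ {X : PSeries} (Y : PSeries), X ∈ momentumZero → ∀ a ≤ α', ∀ b ≤ β',
      coef a b (poisson X Y) = coef a b (finBracket J X Y) := fun Y hX a ha b hb =>
    coef_poisson_eq hX Y ha hb hJ'
  rw [map_add, coef_poisson, coef_poisson, coef_poisson,
    coef_finBracket_congr (fun _ _ _ _ => rfl) (inner H hG),
    coef_finBracket_congr (inner G hF) (fun _ _ _ _ => rfl),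
    coef_finBracket_congr (fun _ _ _ _ => rfl) (inner H hF), swap _ hF, swap _ hG,
    swap _ (finBracket_mem_momentumZero J hF hG), finBracket_jacobi, map_add]

/-! ### Exponentials of operators that raise the degree -/

/-- The operator `δ` raises the degree by at least one; this makes `∑ δ^k / k!` finite in each
coefficient. -/
def RaisesOrder (δ : PSeries →ₗ[ℂ] PSeries) : Prop :=
  ∀ n f, f ∈ ordGE n → δ f ∈ ordGE (n + 1)

lemma RaisesOrder.pow_mem {δ : PSeries →ₗ[ℂ] PSeries} (hδ : RaisesOrder δ) (k : ℕ) {n : ℕ}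
    {f : PSeries} (hf : f ∈ ordGE n) : (δ ^ k) f ∈ ordGE (n + k) := by
  induction k with
  | zero => simpa using hf
  | succ k ih =>
    rw [pow_succ', Module.End.mul_apply]
    exact hδ _ _ ih

lemma RaisesOrder.neg {δ : PSeries →ₗ[ℂ] PSeries} (hδ : RaisesOrder δ) : RaisesOrder (-δ) :=
  fun n f hf => (ordGE (n + 1)).neg_mem (hδ n f hf)

/-- The `k`-th term `δ^k / k!` of the exponential series. -/
noncomputable def expTerm (δ : PSeries →ₗ[ℂ] PSeries) (k : ℕ) : PSeries →ₗ[ℂ] PSeries :=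
  (k.factorial : ℂ)⁻¹ • δ ^ k

lemma expTerm_apply (δ : PSeries →ₗ[ℂ] PSeries) (k : ℕ) (f : PSeries) :
    expTerm δ k f = (k.factorial : ℂ)⁻¹ • (δ ^ k) f := rfl

lemma RaisesOrder.expTerm_mem {δ : PSeries →ₗ[ℂ] PSeries} (hδ : RaisesOrder δ) (k : ℕ) {n : ℕ}
    {f : PSeries} (hf : f ∈ ordGE n) : expTerm δ k f ∈ ordGE (n + k) :=
  (ordGE _).smul_mem _ (hδ.pow_mem k hf)

lemma expTerm_zero (δ : PSeries →ₗ[ℂ] PSeries) (f : PSeries) : expTerm δ 0 f = f := by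
  simp [expTerm_apply]

lemma expTerm_succ (δ : PSeries →ₗ[ℂ] PSeries) (k : ℕ) (f : PSeries) :
    δ (expTerm δ k f) = ((k : ℂ) + 1) • expTerm δ (k + 1) f := by
  rw [expTerm_apply, expTerm_apply, map_smul, smul_smul, pow_succ', Module.End.mul_apply,
    Nat.factorial_succ, Nat.cast_mul, mul_inv, Nat.cast_succ, mul_inv_cancel_left₀]
  exact Nat.cast_add_one_ne_zero k

/-- The exponential `∑ δ^k / k!`. For `δ` raising the degree, the terms omitted from a coefficient
all vanish there, see `coef_formalExp_eq`. -/
noncomputable def formalExp (δ : PSeries →ₗ[ℂ] PSeries) : PSeries →ₗ[ℂ] PSeries where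
  toFun f := ofCoef fun α β =>
    coef α β (∑ k ∈ Finset.range (α.degree + β.degree + 1), expTerm δ k f)
  map_add' f g := PSeries.ext_coef fun α β => by
    simp only [map_add, coef_ofCoef, Finset.sum_add_distrib]
  map_smul' c f := PSeries.ext_coef fun α β => by
    simp only [map_smul, coef_ofCoef, ← Finset.smul_sum, RingHom.id_apply]

lemma coef_formalExp (δ : PSeries →ₗ[ℂ] PSeries) (f : PSeries) (α β : MultiIndex) :
    coef α β (formalExp δ f) =
      coef α β (∑ k ∈ Finset.range (α.degree + β.degree + 1), expTerm δ k f) := rfl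

lemma coef_formalExp_eq {δ : PSeries →ₗ[ℂ] PSeries} (hδ : RaisesOrder δ) {n : ℕ} {f : PSeries}
    (hf : f ∈ ordGE n) {N : ℕ} {α β : MultiIndex} (h : α.degree + β.degree < n + N) :
    coef α β (formalExp δ f) = coef α β (∑ k ∈ Finset.range N, expTerm δ k f) := by
  have key : ∀ {M : ℕ} (M' : ℕ), α.degree + β.degree < n + M → M ≤ M' →
      coef α β (∑ k ∈ Finset.range M, expTerm δ k f) =
        coef α β (∑ k ∈ Finset.range M', expTerm δ k f) := by
    intro M M' h hM
    simp only [map_sum]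
    refine Finset.sum_subset (Finset.range_mono hM) fun k _ hk => ?_
    rw [Finset.mem_range, not_lt] at hk
    exact hδ.expTerm_mem k hf _ _ (by omega)
  rw [coef_formalExp, key (max (α.degree + β.degree + 1) N) (by omega) (le_max_left _ _),
    key (max (α.degree + β.degree + 1) N) h (le_max_right _ _)]

lemma formalExp_sub_mem {δ : PSeries →ₗ[ℂ] PSeries} (hδ : RaisesOrder δ) {n : ℕ} {f : PSeries}
    (hf : f ∈ ordGE n) (N : ℕ) :
    formalExp δ f - ∑ k ∈ Finset.range N, expTerm δ k f ∈ ordGE (n + N) := fun α β h => by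
  rw [map_sub, coef_formalExp_eq hδ hf h, sub_self]

lemma formalExp_sub_self_mem {δ : PSeries →ₗ[ℂ] PSeries} (hδ : RaisesOrder δ) {n : ℕ}
    {f : PSeries} (hf : f ∈ ordGE n) : formalExp δ f - f ∈ ordGE (n + 1) := by
  simpa [expTerm_zero] using formalExp_sub_mem hδ hf 1

lemma formalExp_mem_ordGE {δ : PSeries →ₗ[ℂ] PSeries} (hδ : RaisesOrder δ) {n : ℕ}
    {f : PSeries} (hf : f ∈ ordGE n) : formalExp δ f ∈ ordGE n := by
  simpa using formalExp_sub_mem hδ hf 0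

lemma formalExp_mem_chargeIn {δ : PSeries →ₗ[ℂ] PSeries} {T : Set (ℤ →₀ ℤ)}
    (hδ : ∀ f ∈ chargeIn T, δ f ∈ chargeIn T) {f : PSeries} (hf : f ∈ chargeIn T) :
    formalExp δ f ∈ chargeIn T := by
  have h : ∀ k, (δ ^ k) f ∈ chargeIn T := fun k => by
    induction k with
    | zero => simpa using hf
    | succ k ih =>
      rw [pow_succ', Module.End.mul_apply]
      exact hδ _ ih
  intro α β hT
  rw [coef_formalExp]
  exact (chargeIn T).sum_mem (fun k _ => (chargeIn T).smul_mem _ (h k)) α β hT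

lemma formalExp_eq_self {δ : PSeries →ₗ[ℂ] PSeries} (hδ : RaisesOrder δ) {f : PSeries}
    (hf : δ f = 0) : formalExp δ f = f := by
  refine eq_of_sub_mem_ordGE fun n => ?_
  have h := formalExp_sub_mem hδ (mem_ordGE_zero f) (n + 1)
  rw [Finset.sum_range_succ', expTerm_zero, Finset.sum_eq_zero, zero_add, zero_add] at h
  · exact ordGE_anti n.le_succ h
  · intro k _
    rw [expTerm_apply, pow_succ, Module.End.mul_apply, hf, map_zero, smul_zero]

/-- A product of two partial sums and the partial sum of the Cauchy product differ by terms of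
high degree. -/
lemma sum_square_sub_sum_triangle_mem {s : ℕ} {c : ℕ → ℕ → PSeries}
    (hc : ∀ i j, c i j ∈ ordGE (i + j - s)) (N : ℕ) :
    ∑ i ∈ Finset.range N, ∑ j ∈ Finset.range N, c i j -
      ∑ n ∈ Finset.range N, ∑ x ∈ antidiagonal n, c x.1 x.2 ∈ ordGE (N - s) := by
  have h : ∑ n ∈ Finset.range N, ∑ x ∈ antidiagonal n, c x.1 x.2 =
      ∑ x ∈ Finset.range N ×ˢ Finset.range N with x.1 + x.2 < N, c x.1 x.2 := by
    rw [← Finset.sum_fiberwise_of_maps_to (s := Finset.filter _ _) (t := Finset.range N)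
      (g := fun x : ℕ × ℕ => x.1 + x.2)
      (fun x hx => Finset.mem_range.2 (Finset.mem_filter.1 hx).2)]
    refine Finset.sum_congr rfl fun n hn => Finset.sum_congr ?_ fun _ _ => rfl
    ext ⟨i, j⟩
    simp only [mem_antidiagonal, Finset.mem_filter, Finset.mem_product, Finset.mem_range] at hn ⊢
    omega
  rw [h, ← Finset.sum_product', ← Finset.sum_filter_add_sum_filter_not _
    (fun x : ℕ × ℕ => x.1 + x.2 < N), add_sub_cancel_left]
  refine (ordGE _).sum_mem fun x hx => ordGE_anti ?_ (hc _ _)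
  have := (Finset.mem_filter.1 hx).2
  omega

/-- The Leibniz formula for `δ^n / n!`. -/
lemma expTerm_bilin {B : PSeries →ₗ[ℂ] PSeries →ₗ[ℂ] PSeries} {δ : PSeries →ₗ[ℂ] PSeries}
    {V : Submodule ℂ PSeries} (hV : ∀ f ∈ V, δ f ∈ V)
    (hB : ∀ f ∈ V, ∀ g, δ (B f g) = B (δ f) g + B f (δ g)) {f : PSeries} (hf : f ∈ V)
    (g : PSeries) (n : ℕ) :
    expTerm δ n (B f g) = ∑ x ∈ antidiagonal n, B (expTerm δ x.1 f) (expTerm δ x.2 g) := by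
  have hmem : ∀ k, expTerm δ k f ∈ V := fun k => by
    refine V.smul_mem _ ?_
    induction k with
    | zero => simpa using hf
    | succ k ih =>
      rw [pow_succ', Module.End.mul_apply]
      exact hV _ ih
  induction n with
  | zero => simp [expTerm_zero]
  | succ n ih =>
    have hne : (n : ℂ) + 1 ≠ 0 := Nat.cast_add_one_ne_zero n
    refine smul_right_injective PSeries hne ?_
    simp only
    rw [← expTerm_succ, ih, map_sum]
    have h1 : ∑ x ∈ antidiagonal (n + 1), ((x.1 : ℕ) : ℂ) • B (expTerm δ x.1 f) (expTerm δ x.2 g)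
        = ∑ x ∈ antidiagonal n, B (δ (expTerm δ x.1 f)) (expTerm δ x.2 g) := by
      rw [Finset.Nat.sum_antidiagonal_succ]
      simp only [Nat.cast_zero, zero_smul, zero_add, expTerm_succ, map_smul, LinearMap.smul_apply,
        Nat.cast_succ]
    have h2 : ∑ x ∈ antidiagonal (n + 1), ((x.2 : ℕ) : ℂ) • B (expTerm δ x.1 f) (expTerm δ x.2 g)
        = ∑ x ∈ antidiagonal n, B (expTerm δ x.1 f) (δ (expTerm δ x.2 g)) := by
      rw [Finset.Nat.sum_antidiagonal_succ']
      simp only [Nat.cast_zero, zero_smul, zero_add, expTerm_succ, map_smul, Nat.cast_succ]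
    rw [Finset.sum_congr rfl fun x _ => hB _ (hmem x.1) _, Finset.sum_add_distrib, ← h1, ← h2,
      ← Finset.sum_add_distrib, Finset.smul_sum]
    refine Finset.sum_congr rfl fun x hx => ?_
    rw [← add_smul, ← Nat.cast_add, mem_antidiagonal.1 hx, Nat.cast_succ]

/-- The exponential of a derivation of a bilinear operation is an automorphism of that operation.
The operation may lower the degree by a fixed amount `s`, and `δ` need only be a derivation
for first arguments in `V`. -/
lemma formalExp_bilin {B : PSeries →ₗ[ℂ] PSeries →ₗ[ℂ] PSeries} {s : ℕ}
    (hBs : ∀ m n f g, f ∈ ordGE m → g ∈ ordGE n → B f g ∈ ordGE (m + n - s))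
    {δ : PSeries →ₗ[ℂ] PSeries} (hδ : RaisesOrder δ)
    {V : Submodule ℂ PSeries} (hV : ∀ f ∈ V, δ f ∈ V)
    (hB : ∀ f ∈ V, ∀ g, δ (B f g) = B (δ f) g + B f (δ g)) {f : PSeries} (hf : f ∈ V)
    (g : PSeries) : formalExp δ (B f g) = B (formalExp δ f) (formalExp δ g) := by
  refine eq_of_sub_mem_ordGE fun n => ?_
  -- `B` may lower the degree by `s`, hence the longer partial sums
  set N := n + s with hN
  set f' := ∑ k ∈ Finset.range N, expTerm δ k f
  set g' := ∑ k ∈ Finset.range N, expTerm δ k g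
  have e0 := formalExp_sub_mem hδ (mem_ordGE_zero (B f g)) N
  rw [Finset.sum_congr rfl fun k _ => expTerm_bilin hV hB hf g k] at e0
  have e1 := sum_square_sub_sum_triangle_mem (s := s)
    (c := fun i j => B (expTerm δ i f) (expTerm δ j g)) (fun i j => hBs _ _ _ _
      (by simpa using hδ.expTerm_mem i (mem_ordGE_zero f))
      (by simpa using hδ.expTerm_mem j (mem_ordGE_zero g))) N
  have e2 : ∑ i ∈ Finset.range N, ∑ j ∈ Finset.range N, B (expTerm δ i f) (expTerm δ j g) =
      B f' g' := by
    simp only [f', g', map_sum, LinearMap.sum_apply]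
    rw [Finset.sum_comm]
  rw [e2] at e1
  have e3 := hBs _ _ _ _ (formalExp_sub_mem hδ (mem_ordGE_zero f) N)
    (mem_ordGE_zero (formalExp δ g))
  have e4 := hBs _ _ _ _ (mem_ordGE_zero f') (formalExp_sub_mem hδ (mem_ordGE_zero g) N)
  have hle : ∀ {M : ℕ} {x : PSeries}, n ≤ M → x ∈ ordGE M → x ∈ ordGE n := fun h hx =>
    ordGE_anti h hx
  have := (ordGE n).sub_mem ((ordGE n).sub_mem ((ordGE n).sub_mem (hle (by omega) e0)
    (hle (by omega) e1)) (hle (by omega) e3)) (hle (by omega) e4)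
  convert this using 1
  simp only [map_sub, LinearMap.sub_apply]
  abel

lemma sum_antidiagonal_neg_one_pow (n : ℕ) :
    ∑ x ∈ antidiagonal n, (-1 : ℂ) ^ x.1 * (x.1.factorial : ℂ)⁻¹ * (x.2.factorial : ℂ)⁻¹ =
      if n = 0 then 1 else 0 := by
  have h := congrArg (PowerSeries.coeff n) (PowerSeries.exp_mul_exp_neg_eq_one (A := ℂ))
  rw [mul_comm, PowerSeries.coeff_mul, PowerSeries.coeff_one] at h
  rw [← h]
  refine Finset.sum_congr rfl fun x _ => ?_
  simp [PowerSeries.evalNegHom, PowerSeries.coeff_rescale, PowerSeries.coeff_exp]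

lemma formalExp_neg_formalExp {δ : PSeries →ₗ[ℂ] PSeries} (hδ : RaisesOrder δ) (f : PSeries) :
    formalExp (-δ) (formalExp δ f) = f := by
  refine eq_of_sub_mem_ordGE fun n => ?_
  set N := n + 1
  set f' := ∑ k ∈ Finset.range N, expTerm δ k f with hf'
  have e1 := formalExp_mem_ordGE hδ.neg (formalExp_sub_mem hδ (mem_ordGE_zero f) N)
  have e2 := formalExp_sub_mem hδ.neg (mem_ordGE_zero f') N
  have e3 := sum_square_sub_sum_triangle_mem (s := 0)
    (c := fun i j => ((-1 : ℂ) ^ i * (i.factorial : ℂ)⁻¹ * (j.factorial : ℂ)⁻¹) • (δ ^ (i + j)) f)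
    (fun i j => (ordGE _).smul_mem _ (by
      simpa using hδ.pow_mem (i + j) (mem_ordGE_zero f))) N
  have e4 : ∑ i ∈ Finset.range N, ∑ j ∈ Finset.range N,
      ((-1 : ℂ) ^ i * (i.factorial : ℂ)⁻¹ * (j.factorial : ℂ)⁻¹) • (δ ^ (i + j)) f =
      ∑ i ∈ Finset.range N, expTerm (-δ) i f' := by
    refine Finset.sum_congr rfl fun i _ => ?_
    rw [hf', map_sum]
    refine Finset.sum_congr rfl fun j _ => ?_
    rw [expTerm_apply, expTerm_apply, map_smul, smul_smul, pow_add]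
    have h : (-δ) ^ i = ((-1 : ℂ) ^ i) • δ ^ i := by
      rw [← neg_one_smul ℂ δ, smul_pow]
    rw [h, LinearMap.smul_apply, smul_smul, Module.End.mul_apply]
    congr 1
    ring
  have e5 : ∑ m ∈ Finset.range N, ∑ x ∈ antidiagonal m,
      ((-1 : ℂ) ^ x.1 * (x.1.factorial : ℂ)⁻¹ * (x.2.factorial : ℂ)⁻¹) • (δ ^ (x.1 + x.2)) f
        = f := by
    rw [Finset.sum_congr rfl fun m _ => Finset.sum_congr rfl fun x hx => by
      rw [mem_antidiagonal.1 hx]]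
    simp only [← Finset.sum_smul, sum_antidiagonal_neg_one_pow]
    rw [Finset.sum_range_succ', Finset.sum_eq_zero]
    · simp
    · intro k _
      simp
  rw [e4, e5] at e3
  have hle : ∀ {M : ℕ} {x : PSeries}, n ≤ M → x ∈ ordGE M → x ∈ ordGE n := fun h hx =>
    ordGE_anti h hx
  have := (ordGE n).add_mem ((ordGE n).add_mem (hle (by omega) e1) (hle (by omega) e2))
    (hle (by omega) e3)
  convert this using 1
  simp only [map_sub]
  abel

/-! ### Exponentials of Poisson brackets -/

lemma raisesOrder_poisson {G : PSeries} (hG : G ∈ ordGE 3) : RaisesOrder (poisson G) :=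
  fun n _ hf => ordGE_anti (by omega) (poisson_mem_ordGE hG hf)

lemma formalExp_mul {G : PSeries} (hG : G ∈ ordGE 3) (hG' : G ∈ momentumZero) (f g : PSeries) :
    formalExp (poisson G) (f * g) = formalExp (poisson G) f * formalExp (poisson G) g :=
  formalExp_bilin (B := LinearMap.mul ℂ PSeries) (s := 0) (V := ⊤)
    (fun _ _ _ _ hf hg => mul_mem_ordGE hf hg) (raisesOrder_poisson hG) (fun _ _ => trivial)
    (fun f _ g => poisson_leibniz hG' f g) trivial g

lemma formalExp_poisson {G : PSeries} (hG : G ∈ ordGE 3) (hG' : G ∈ momentumZero) {f : PSeries}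
    (hf : f ∈ momentumZero) (g : PSeries) :
    formalExp (poisson G) (poisson f g) =
      poisson (formalExp (poisson G) f) (formalExp (poisson G) g) :=
  formalExp_bilin (B := poisson) (s := 2) (V := momentumZero)
    (fun _ _ _ _ hf hg => poisson_mem_ordGE hf hg) (raisesOrder_poisson hG)
    (fun _ hf => poisson_mem_momentumZero hG' hf)
    (fun _ hf g => poisson_jacobi hG' hf g) hf g

lemma formalHam_le_momentumZero {F : FormalSeries} (hF : F ∈ formalHam) :
    ofCoef F ∈ momentumZero := by
  intro α β h
  rw [Set.mem_ofPred_eq, ← momentum_eq] at h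
  exact hF.2.2 α β h

lemma orderGE_mem_ordGE {F : FormalSeries} {d : ℕ} (hF : F ∈ orderGE d) :
    ofCoef F ∈ ordGE (d + 2) := hF.2

lemma expAd_eq {G : FormalSeries} (hG : G ∈ orderGE 1) (H : FormalSeries) :
    ofCoef (expAd G H) = formalExp (poisson (ofCoef G)) (ofCoef H) := by
  have hit : ∀ k, (bracket G)^[k] H = (poisson (ofCoef G) ^ k) (ofCoef H) := fun k => by
    induction k with
    | zero => rfl
    | succ k ih =>
      rw [Function.iterate_succ_apply', ih, pow_succ', Module.End.mul_apply]
      exact bracket_eq_poisson (formalHam_le_momentumZero hG.1) _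
  have hR := raisesOrder_poisson (orderGE_mem_ordGE hG)
  refine PSeries.ext_coef fun α β => ?_
  rw [coef_formalExp, map_sum]
  change ∑ᶠ k, _ = _
  have hterm : ∀ k : ℕ, ((k.factorial : ℂ)⁻¹) * ((bracket G)^[k] H) α β =
      coef α β (expTerm (poisson (ofCoef G)) k (ofCoef H)) := fun k => by
    rw [hit, expTerm_apply, map_smul]
    rfl
  simp only [hterm]
  refine finsum_eq_sum_of_support_subset _ fun k hk => ?_
  by_contra hlt
  rw [Finset.mem_coe, Finset.mem_range, not_lt] at hlt
  exact hk (hR.expTerm_mem k (mem_ordGE_zero _) _ _ (by omega))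

/-! ### Quadratic Hamiltonians and non-resonance -/

/-- The frequency `ω · l` of the charge `l`. -/
noncomputable def freq (ω : ℤ → ℝ) (l : ℤ →₀ ℤ) : ℝ := l.sum fun j n => ω j * (n : ℝ)

lemma add_single_eq_single {α : MultiIndex} {j k : ℤ} :
    α + single k 1 = single j 1 ↔ α = 0 ∧ k = j := by
  refine ⟨fun h => ?_, ?_⟩
  · have hd := congrArg Finsupp.degree h
    rw [map_add, Finsupp.degree_single, Finsupp.degree_single] at hd
    obtain rfl : α = 0 := (Finsupp.degree_eq_zero_iff α).1 (by omega)
    rw [zero_add] at h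
    exact ⟨rfl, (Finsupp.single_left_inj one_ne_zero).1 h⟩
  · rintro ⟨rfl, rfl⟩
    exact zero_add _

lemma add_single_ne_zero (α : MultiIndex) (k : ℤ) : α + single k 1 ≠ 0 := fun h => by
  have hd := congrArg Finsupp.degree h
  rw [map_add, Finsupp.degree_single, map_zero] at hd
  omega

/-- The variable `u_j`. -/
noncomputable def varU (j : ℤ) : PSeries :=
  (MvPowerSeries.X j : MvPowerSeries ℤ (MvPowerSeries ℤ ℂ))

/-- The variable `ū_j`. -/
noncomputable def varUbar (j : ℤ) : PSeries :=
  (MvPowerSeries.C (MvPowerSeries.X j) : MvPowerSeries ℤ (MvPowerSeries ℤ ℂ))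

lemma coef_varU_mul (j : ℤ) (α β : MultiIndex) (f : PSeries) :
    coef α β (varU j * f) = if single j 1 ≤ α then coef (α - single j 1) β f else 0 := by
  refine (congrArg (MvPowerSeries.coeff β)
    (MvPowerSeries.coeff_monomial_mul α (single j 1) f (1 : MvPowerSeries ℤ ℂ))).trans ?_
  split_ifs
  · rw [one_mul]
    rfl
  · rfl

lemma coef_varUbar_mul (j : ℤ) (α β : MultiIndex) (f : PSeries) :
    coef α β (varUbar j * f) = if single j 1 ≤ β then coef α (β - single j 1) f else 0 := by
  refine (congrArg (MvPowerSeries.coeff β)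
    (MvPowerSeries.coeff_C_mul α f (MvPowerSeries.X j : MvPowerSeries ℤ ℂ))).trans ?_
  refine (MvPowerSeries.coeff_monomial_mul β (single j 1) _ (1 : ℂ)).trans ?_
  split_ifs
  · rw [one_mul]
    rfl
  · rfl

lemma coef_varU (j : ℤ) (α β : MultiIndex) :
    coef α β (varU j) = if α = single j 1 ∧ β = 0 then 1 else 0 := by
  rw [← mul_one (varU j), coef_varU_mul]
  split_ifs with h1 h2 h2
  · rw [h2.1, h2.2, tsub_self, coef_one, if_pos ⟨rfl, rfl⟩]
  · rw [coef_one, if_neg]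
    rintro ⟨h3, h4⟩
    exact h2 ⟨le_antisymm (tsub_eq_zero_iff_le.1 h3) h1, h4⟩
  · exact absurd h2.1.ge h1
  · rfl

lemma coef_varUbar (j : ℤ) (α β : MultiIndex) :
    coef α β (varUbar j) = if α = 0 ∧ β = single j 1 then 1 else 0 := by
  rw [← mul_one (varUbar j), coef_varUbar_mul]
  split_ifs with h1 h2 h2
  · rw [h2.1, h2.2, tsub_self, coef_one, if_pos ⟨rfl, rfl⟩]
  · rw [coef_one, if_neg]
    rintro ⟨h3, h4⟩
    exact h2 ⟨h3, le_antisymm (tsub_eq_zero_iff_le.1 h4) h1⟩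
  · exact absurd h2.2.ge h1
  · rfl

lemma coef_varU_mul_dU (j : ℤ) (α β : MultiIndex) (f : PSeries) :
    coef α β (varU j * dU j f) = (α j : ℂ) * coef α β f := by
  rw [coef_varU_mul]
  split_ifs with h
  · obtain ⟨α', rfl⟩ := exists_add_of_le h
    rw [add_comm, add_tsub_cancel_right, coef_dU]
    simp
  · rw [Finsupp.single_le_iff, Nat.one_le_iff_ne_zero, not_not] at h
    rw [h, Nat.cast_zero, zero_mul]

lemma coef_varUbar_mul_dUbar (j : ℤ) (α β : MultiIndex) (f : PSeries) :
    coef α β (varUbar j * dUbar j f) = (β j : ℂ) * coef α β f := by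
  rw [coef_varUbar_mul]
  split_ifs with h
  · obtain ⟨β', rfl⟩ := exists_add_of_le h
    rw [add_comm, add_tsub_cancel_right, coef_dUbar]
    simp
  · rw [Finsupp.single_le_iff, Nat.one_le_iff_ne_zero, not_not] at h
    rw [h, Nat.cast_zero, zero_mul]

lemma dU_varU (j k : ℤ) : dU k (varU j) = if k = j then 1 else 0 := by
  refine PSeries.ext_coef fun α β => ?_
  rw [coef_dU, coef_varU]
  simp only [add_single_eq_single]
  by_cases h : k = j
  · rw [if_pos h, coef_one]
    simp only [h, and_true]
    split_ifs with h'
    · simp [h'.1]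
    · simp
  · simp [h]

lemma dUbar_varU (j k : ℤ) : dUbar k (varU j) = 0 := by
  refine PSeries.ext_coef fun α β => ?_
  rw [coef_dUbar, coef_varU, if_neg fun h => add_single_ne_zero β k h.2, mul_zero, map_zero]

lemma poisson_varU {F : PSeries} (hF : F ∈ momentumZero) (j : ℤ) :
    poisson F (varU j) = -Complex.I • dUbar j F := by
  refine PSeries.ext_coef fun α β => ?_
  rw [coef_poisson_eq hF _ le_rfl le_rfl (Finset.subset_union_left (s₂ := {j}))]
  congr 1
  rw [finBracket, Finset.sum_eq_single j]
  · rw [modeBracket, dU_varU, dUbar_varU, if_pos rfl, mul_zero, mul_one, zero_sub, smul_neg,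
      neg_smul]
  · intro k _ hk
    rw [modeBracket, dU_varU, dUbar_varU, if_neg hk, mul_zero, mul_zero, sub_zero]
  · intro h
    exact absurd (by simp) h

lemma coef_quadHam (ω : ℤ → ℝ) (α β : MultiIndex) (j : ℤ) :
    coef (α + single j 1) β (ofCoef (quadHam ω)) =
      if α = 0 ∧ β = single j 1 then (ω j : ℂ) else 0 := by
  rw [coef_ofCoef, quadHam, finsum_eq_single _ j]
  · simp only [add_single_eq_single, and_true]
  · intro k hk
    rw [if_neg]
    rintro ⟨h, -⟩
    exact hk (add_single_eq_single.1 h).2.symm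

lemma coef_quadHam' (ω : ℤ → ℝ) (α β : MultiIndex) (j : ℤ) :
    coef α (β + single j 1) (ofCoef (quadHam ω)) =
      if α = single j 1 ∧ β = 0 then (ω j : ℂ) else 0 := by
  rw [coef_ofCoef, quadHam, finsum_eq_single _ j]
  · simp only [add_single_eq_single, and_true]
  · intro k hk
    rw [if_neg]
    rintro ⟨-, h⟩
    exact hk (add_single_eq_single.1 h).2.symm

lemma dU_quadHam (ω : ℤ → ℝ) (j : ℤ) :
    dU j (ofCoef (quadHam ω)) = (ω j : ℂ) • varUbar j := by
  refine PSeries.ext_coef fun α β => ?_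
  rw [coef_dU, coef_quadHam, map_smul, coef_varUbar]
  split_ifs with h
  · simp [h.1]
  · simp

lemma dUbar_quadHam (ω : ℤ → ℝ) (j : ℤ) :
    dUbar j (ofCoef (quadHam ω)) = (ω j : ℂ) • varU j := by
  refine PSeries.ext_coef fun α β => ?_
  rw [coef_dUbar, coef_quadHam', map_smul, coef_varU]
  split_ifs with h
  · simp [h.2]
  · simp

lemma actionHam_le_diagSeries {Z : FormalSeries} (hZ : Z ∈ actionHam) : ofCoef Z ∈ diagSeries :=
  mem_diagSeries.2 hZ.2

/-- `{D_ω, ·}` is diagonal on monomials, with eigenvalue `-i ω · (α - β)`. -/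
lemma coef_poisson_quadHam (ω : ℤ → ℝ) (g : PSeries) (α β : MultiIndex) :
    coef α β (poisson (ofCoef (quadHam ω)) g) =
      -(Complex.I * freq ω (charge α β)) * coef α β g := by
  have hD := diag_le_momentumZero (actionHam_le_diagSeries (quadHam_mem ω))
  rw [coef_poisson_eq hD g le_rfl le_rfl
    (Finset.subset_union_left (s₂ := (charge α β).support)), finBracket, map_smul, map_sum, freq,
    Finsupp.sum_of_support_subset (charge α β)
      (Finset.subset_union_right (s₁ := relevantModes α β)) _ (by simp)]
  rw [Complex.ofReal_sum, smul_eq_mul, neg_mul, mul_assoc, ← mul_neg, Finset.sum_mul,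
    ← Finset.sum_neg_distrib]
  congr 1
  refine Finset.sum_congr rfl fun j _ => ?_
  rw [modeBracket, dU_quadHam, dUbar_quadHam, smul_mul_assoc, smul_mul_assoc, map_sub,
    map_smul, map_smul, coef_varUbar_mul_dUbar, coef_varU_mul_dU, charge_apply]
  push_cast
  simp only [smul_eq_mul]
  ring

lemma freq_ne_zero {ω : ℤ → ℝ} (hω : NonResonant ω) {α β : MultiIndex} (h : α ≠ β) :
    (freq ω (charge α β) : ℂ) ≠ 0 :=
  Complex.ofReal_ne_zero.2 (hω _ fun h0 => h (charge_eq_zero.1 h0))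

/-- The centralizer of `K = D_ω + ⋯` consists of series in the actions: `{K - D_ω, ·}` preserves
the charge and raises the degree, so an off-diagonal monomial of lowest degree in its charge
cannot cancel. -/
lemma mem_diagSeries_of_poisson_eq_zero {ω : ℤ → ℝ} (hω : NonResonant ω) {K g : PSeries}
    (hK : K ∈ diagSeries) (hK' : K - ofCoef (quadHam ω) ∈ ordGE 3) (h : poisson K g = 0) :
    g ∈ diagSeries := by
  have hD := (actionHam_le_diagSeries (quadHam_mem ω))
  refine mem_diagSeries.2 fun α β => ?_
  induction hn : α.degree + β.degree using Nat.strong_induction_on generalizing α β with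
  | _ n ih =>
    intro hne
    have h0 : coef α β (poisson (K - ofCoef (quadHam ω)) g) = 0 := by
      by_contra hc
      obtain ⟨j, a, b, a', b', h1, h2, h3, h4, -⟩ := exists_of_coef_finBracket_ne_zero hc
      have e1 : ¬ a.degree + b.degree < 3 := fun h => h3 (hK' _ _ h)
      obtain rfl : a = b := by_contra fun h => h3 (mem_diagSeries.1
        (diagSeries.sub_mem hK hD) _ _ h)
      have e2 : a' ≠ b' := by
        rintro rfl
        exact hne (add_right_cancel (h1.symm.trans h2))
      have h5 := congrArg Finsupp.degree h1
      have h6 := congrArg Finsupp.degree h2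
      simp only [map_add, Finsupp.degree_single] at h5 h6
      exact h4 (ih _ (by omega) a' b' rfl e2)
    rw [map_sub, LinearMap.sub_apply, h, zero_sub, map_neg, neg_eq_zero, coef_poisson_quadHam] at h0
    exact (mul_eq_zero.1 h0).resolve_left
      (neg_ne_zero.2 (mul_ne_zero Complex.I_ne_zero (freq_ne_zero hω hne)))

/-! ### Derivatives with respect to the actions -/

/-- The derivative `∂Z/∂I_j` of a series `Z` in the actions `I_j = |u_j|²`. -/
noncomputable def dAction (j : ℤ) (Z : PSeries) : PSeries :=
  ofCoef fun α β => ((β j : ℂ) + 1) * coef (α + single j 1) (β + single j 1) Z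

lemma coef_dAction (j : ℤ) (Z : PSeries) (α β : MultiIndex) :
    coef α β (dAction j Z) = ((β j : ℂ) + 1) * coef (α + single j 1) (β + single j 1) Z := rfl

lemma dAction_mem {Z : PSeries} (hZ : Z ∈ diagSeries) (j : ℤ) : dAction j Z ∈ diagSeries :=
  mem_diagSeries.2 fun α β h => by
    rw [coef_dAction, mem_diagSeries.1 hZ _ _ fun h' => h (add_right_cancel h'), mul_zero]

lemma dUbar_eq_varU_mul_dAction {Z : PSeries} (hZ : Z ∈ diagSeries) (j : ℤ) :
    dUbar j Z = varU j * dAction j Z := by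
  refine PSeries.ext_coef fun α β => ?_
  rw [coef_varU_mul, coef_dUbar]
  split_ifs with h
  · rw [coef_dAction, tsub_add_cancel_of_le h]
  · rw [mem_diagSeries.1 hZ, mul_zero]
    rintro rfl
    exact h le_add_self

lemma varU_mem_chargeIn (j : ℤ) : varU j ∈ chargeIn {charge (single j 1) 0} := by
  intro α β h
  rw [coef_varU, if_neg]
  rintro ⟨rfl, rfl⟩
  exact h rfl

lemma diag_mul_mem {T : Set (ℤ →₀ ℤ)} {Z f : PSeries} (hZ : Z ∈ diagSeries)
    (hf : f ∈ chargeIn T) : Z * f ∈ chargeIn T := by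
  simpa using mul_mem_chargeIn hZ hf

lemma poisson_diag_mem {T : Set (ℤ →₀ ℤ)} {Z f : PSeries} (hZ : Z ∈ diagSeries)
    (hf : f ∈ chargeIn T) : poisson Z f ∈ chargeIn T := by
  simpa using poisson_mem_chargeIn hZ hf

lemma eq_zero_of_mem_chargeIn_compl {T : Set (ℤ →₀ ℤ)} {f : PSeries} (h1 : f ∈ chargeIn T)
    (h2 : f ∈ chargeIn Tᶜ) : f = 0 := by
  refine PSeries.ext_coef fun α β => ?_
  by_cases h : charge α β ∈ T
  · rw [h2 α β (not_not.2 h), map_zero]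
  · rw [h1 α β h, map_zero]

/-- A linear map that respects the product and the Poisson bracket (with a momentum-conserving first
argument) and is the identity up to terms of higher degree; the last property makes it
bijective. -/
structure UnipotentAut (Φ : PSeries →ₗ[ℂ] PSeries) : Prop where
  map_one : Φ 1 = 1
  map_mul : ∀ f g, Φ (f * g) = Φ f * Φ g
  map_poisson : ∀ f ∈ momentumZero, ∀ g, Φ (poisson f g) = poisson (Φ f) (Φ g)
  sub_mem : ∀ n, ∀ f ∈ ordGE n, Φ f - f ∈ ordGE (n + 1)

/-- An automorphism that preserves the series in the actions commutes with `∂/∂I_j` on them. This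
is seen by applying it to `{Z, u_j} = -i (∂Z/∂I_j) u_j` and comparing the parts of charge
`e_j`. -/
lemma UnipotentAut.dAction_map {Φ : PSeries →ₗ[ℂ] PSeries} (hΦ : UnipotentAut Φ)
    (hdiag : ∀ f ∈ diagSeries, Φ f ∈ diagSeries) {Z : PSeries} (hZ : Z ∈ diagSeries) (j : ℤ) :
    dAction j (Φ Z) = Φ (dAction j Z) := by
  have hY := hdiag Z hZ
  have hW := hdiag _ (dAction_mem hZ j)
  set Y := Φ Z
  set W := Φ (dAction j Z)
  set ψ := Φ (varU j) with hψ
  have h1 : poisson Y ψ = -Complex.I • (W * ψ) := by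
    rw [← hΦ.map_poisson Z (diag_le_momentumZero hZ), poisson_varU (diag_le_momentumZero hZ),
      dUbar_eq_varU_mul_dAction hZ, map_smul, hΦ.map_mul, mul_comm]
  -- the part of `ψ` of charge `e_j` has the form `u_j * a` with `a` diagonal
  set a : PSeries := ofCoef fun α β => if α = β then coef (α + single j 1) β ψ else 0 with ha'
  have hca : ∀ α β, coef α β a = if α = β then coef (α + single j 1) β ψ else 0 := fun _ _ => rfl
  have ha : a ∈ diagSeries := mem_diagSeries.2 fun α β h => by rw [hca, if_neg h]
  have ha0 : a ≠ 0 := by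
    intro h0
    have h2 := hca 0 0
    have h3 := hΦ.sub_mem 1 (varU j) (fun α β h => by
      rw [coef_varU, if_neg]
      rintro ⟨rfl, rfl⟩
      simp at h) (single j 1) 0 (by simp)
    rw [map_sub, coef_varU, if_pos ⟨rfl, rfl⟩, sub_eq_zero] at h3
    rw [h0, map_zero, if_pos rfl, zero_add, h3] at h2
    exact zero_ne_one h2
  have hρ : ψ - a * varU j ∈ chargeIn {charge (single j 1) 0}ᶜ := by
    intro α β h
    have hαβ : α = β + single j 1 := by
      rw [Set.mem_compl_iff, not_not, Set.mem_singleton_iff] at h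
      have h5 : charge α β + charge 0 (single j 1) = 0 := by
        rw [h, ← charge_add, charge_eq_zero, add_zero, zero_add]
      rwa [← charge_add, charge_eq_zero, add_zero] at h5
    rw [map_sub, mul_comm, coef_varU_mul, hαβ, if_pos le_add_self, add_tsub_cancel_right, hca,
      if_pos rfl, sub_self]
  set ρ := ψ - a * varU j
  have hψ' : ψ = a * varU j + ρ := (add_sub_cancel _ _).symm
  have h2 : poisson Y (a * varU j) = -Complex.I • (dAction j Y * (a * varU j)) := by
    rw [poisson_leibniz (diag_le_momentumZero hY), poisson_diag hY ha, zero_mul, zero_add,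
      poisson_varU (diag_le_momentumZero hY), dUbar_eq_varU_mul_dAction hY, mul_smul_comm]
    congr 1
    ring
  have h3 : Complex.I • ((W - dAction j Y) * (a * varU j)) =
      -poisson Y ρ + -Complex.I • (W * ρ) := by
    rw [hψ', map_add, h2, mul_add, smul_add] at h1
    rw [sub_mul, smul_sub]
    simp only [neg_smul] at h1 ⊢
    linear_combination h1
  have h4 : (W - dAction j Y) * (a * varU j) ∈ chargeIn {charge (single j 1) 0} :=
    diag_mul_mem (diagSeries.sub_mem hW (dAction_mem hY j))
      (diag_mul_mem ha (varU_mem_chargeIn j))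
  have h5 := eq_zero_of_mem_chargeIn_compl ((chargeIn _).smul_mem Complex.I h4) (by
    rw [h3]
    exact (chargeIn _).add_mem ((chargeIn _).neg_mem (poisson_diag_mem hY hρ))
      ((chargeIn _).smul_mem _ (diag_mul_mem hW hρ)))
  have h6 : a * varU j ≠ 0 := by
    refine mul_ne_zero ha0 fun h => ?_
    have := coef_varU j (single j 1) 0
    rw [h, map_zero, if_pos ⟨rfl, rfl⟩] at this
    exact zero_ne_one this
  exact (sub_eq_zero.1 ((mul_eq_zero.1 ((smul_eq_zero.1 h5).resolve_left
    Complex.I_ne_zero)).resolve_right h6)).symm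

/-- A series in the actions is determined by its derivatives and constant term, so an automorphism
that is the identity to leading order and commutes with all `∂/∂I_j` is the identity. -/
lemma UnipotentAut.apply_diag {Φ : PSeries →ₗ[ℂ] PSeries} (hΦ : UnipotentAut Φ)
    (hdiag : ∀ f ∈ diagSeries, Φ f ∈ diagSeries) {Z : PSeries} (hZ : Z ∈ diagSeries) :
    Φ Z = Z := by
  refine eq_of_sub_mem_ordGE fun n => ?_
  refine ordGE_anti n.le_succ ?_
  induction n generalizing Z with
  | zero => exact hΦ.sub_mem 0 Z (mem_ordGE_zero Z)
  | succ n ih =>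
    intro α β h
    by_cases hαβ : α = β
    swap
    · exact mem_diagSeries.1 (diagSeries.sub_mem (hdiag Z hZ) hZ) _ _ hαβ
    subst hαβ
    by_cases hα : α = 0
    · exact ih hZ _ _ (by simp [hα])
    obtain ⟨j, hj⟩ := Finsupp.ne_iff.1 hα
    have hle : single j 1 ≤ α := by
      rw [Finsupp.single_le_iff]
      exact Nat.one_le_iff_ne_zero.2 hj
    obtain ⟨γ, rfl⟩ := exists_add_of_le hle
    rw [add_comm (single j 1) γ] at h ⊢
    simp only [map_add, Finsupp.degree_single] at h
    have h1 := ih (dAction_mem hZ j) γ γ (by omega)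
    rw [← hΦ.dAction_map hdiag hZ, map_sub, coef_dAction, coef_dAction, ← mul_sub] at h1
    rw [map_sub]
    exact (mul_eq_zero.1 h1).resolve_left (Nat.cast_add_one_ne_zero _)

lemma UnipotentAut.eq_of_diag {Φ : PSeries →ₗ[ℂ] PSeries} (hΦ : UnipotentAut Φ) {ω : ℤ → ℝ}
    (hω : NonResonant ω) {K : PSeries} (hK : K ∈ diagSeries) (hK' : Φ K ∈ diagSeries)
    (hD : Φ K - ofCoef (quadHam ω) ∈ ordGE 3) : Φ K = K := by
  refine hΦ.apply_diag (fun f hf => ?_) hK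
  refine mem_diagSeries_of_poisson_eq_zero hω hK' hD ?_
  rw [← hΦ.map_poisson K (diag_le_momentumZero hK), poisson_diag hK hf, map_zero]

lemma unipotentAut_formalExp {G : PSeries} (hG : G ∈ ordGE 3) (hG' : G ∈ momentumZero) :
    UnipotentAut (formalExp (poisson G)) where
  map_one := by
    refine formalExp_eq_self (raisesOrder_poisson hG) ?_
    have h := poisson_leibniz hG' 1 1
    rw [mul_one, mul_one, one_mul] at h
    exact left_eq_add.1 h
  map_mul := formalExp_mul hG hG'
  map_poisson := fun _ hf g => formalExp_poisson hG hG' hf g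
  sub_mem := fun _ _ hf => formalExp_sub_self_mem (raisesOrder_poisson hG) hf

lemma UnipotentAut.mem_ordGE {Φ : PSeries →ₗ[ℂ] PSeries} (hΦ : UnipotentAut Φ) {n : ℕ}
    {f : PSeries} (hf : f ∈ ordGE n) : Φ f ∈ ordGE n := by
  have := (ordGE n).add_mem (ordGE_anti n.le_succ (hΦ.sub_mem n f hf)) hf
  rwa [sub_add_cancel] at this

lemma UnipotentAut.comp {Φ Ψ : PSeries →ₗ[ℂ] PSeries} (hΦ : UnipotentAut Φ)
    (hΨ : UnipotentAut Ψ) (hΨ' : ∀ f ∈ momentumZero, Ψ f ∈ momentumZero) :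
    UnipotentAut (Φ ∘ₗ Ψ) where
  map_one := by rw [LinearMap.comp_apply, hΨ.map_one, hΦ.map_one]
  map_mul f g := by simp only [LinearMap.comp_apply, hΨ.map_mul, hΦ.map_mul]
  map_poisson f hf g := by
    simp only [LinearMap.comp_apply, hΨ.map_poisson f hf, hΦ.map_poisson _ (hΨ' f hf)]
  sub_mem n f hf := by
    rw [LinearMap.comp_apply, ← sub_add_sub_cancel _ (Ψ f)]
    exact (ordGE _).add_mem (hΦ.sub_mem n _ (hΨ.mem_ordGE hf)) (hΨ.sub_mem n f hf)

/-- Two diagonal series `e^{{S,·}} H` and `e^{{G,·}} H` coincide: `e^{{G,·}} e^{{-S,·}}` carries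
the first to the second. -/
lemma formalExp_eq_of_diag {ω : ℤ → ℝ} (hω : NonResonant ω) {S G H : PSeries}
    (hS : S ∈ ordGE 3) (hS' : S ∈ momentumZero) (hG : G ∈ ordGE 3) (hG' : G ∈ momentumZero)
    (h1 : formalExp (poisson S) H ∈ diagSeries) (h2 : formalExp (poisson G) H ∈ diagSeries)
    (hD : formalExp (poisson G) H - ofCoef (quadHam ω) ∈ ordGE 3) :
    formalExp (poisson G) H = formalExp (poisson S) H := by
  have hneg : poisson (-S) = -poisson S := map_neg _ _
  have hU := unipotentAut_formalExp ((ordGE 3).neg_mem hS) (momentumZero.neg_mem hS')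
  have hΦ := (unipotentAut_formalExp hG hG').comp hU fun f hf =>
    formalExp_mem_chargeIn (fun f hf => poisson_mem_momentumZero (momentumZero.neg_mem hS') hf) hf
  have happ : (formalExp (poisson G) ∘ₗ formalExp (poisson (-S))) (formalExp (poisson S) H) =
      formalExp (poisson G) H := by
    rw [LinearMap.comp_apply, hneg, formalExp_neg_formalExp (raisesOrder_poisson hS)]
  have := hΦ.eq_of_diag hω h1 (by rwa [happ]) (by rwa [happ])
  rwa [happ] at this

/-! ### Normalization degree by degree -/

lemma pow_poisson_sub_mem {S S' H : PSeries} {n : ℕ} (hS : S ∈ ordGE 3) (hS' : S' ∈ ordGE 3)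
    (hd : S' - S ∈ ordGE (n + 2)) (hH : H ∈ ordGE 2) (k : ℕ) :
    (poisson S' ^ (k + 1)) H - (poisson S ^ (k + 1)) H ∈ ordGE (n + k + 2) := by
  induction k with
  | zero =>
    rw [zero_add, pow_one, pow_one, ← LinearMap.sub_apply, ← map_sub]
    exact ordGE_anti (by omega) (poisson_mem_ordGE hd hH)
  | succ k ih =>
    have h1 := (raisesOrder_poisson hS').pow_mem 0 (raisesOrder_poisson hS' _ _ ih)
    have h2 := poisson_mem_ordGE hd ((raisesOrder_poisson hS).pow_mem (k + 1) hH)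
    have h3 := (ordGE (n + (k + 1) + 2)).add_mem (ordGE_anti (by omega) h1)
      (ordGE_anti (by omega) h2)
    convert h3 using 1
    rw [pow_succ' _ (k + 1), pow_succ' _ (k + 1)]
    simp only [Module.End.mul_apply, map_sub, LinearMap.sub_apply, pow_zero, Module.End.one_apply]
    abel

/-- Changing the generator in high degree changes the exponential by a bracket, to leading order. -/
lemma formalExp_poisson_sub_mem {S S' H : PSeries} {n : ℕ} (hS : S ∈ ordGE 3)
    (hS' : S' ∈ ordGE 3) (hd : S' - S ∈ ordGE (n + 2)) (hH : H ∈ ordGE 2) :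
    formalExp (poisson S') H - formalExp (poisson S) H - poisson (S' - S) H ∈ ordGE (n + 3) := by
  have h1 := formalExp_sub_mem (raisesOrder_poisson hS') hH (n + 1 + 1)
  have h2 := formalExp_sub_mem (raisesOrder_poisson hS) hH (n + 1 + 1)
  have h3 : ∑ k ∈ Finset.range n, (expTerm (poisson S') (k + 1 + 1) H -
      expTerm (poisson S) (k + 1 + 1) H) ∈ ordGE (n + 3) := by
    refine (ordGE _).sum_mem fun k _ => ?_
    rw [expTerm_apply, expTerm_apply, ← smul_sub]
    exact (ordGE _).smul_mem _ (ordGE_anti (by omega) (pow_poisson_sub_mem hS hS' hd hH (k + 1)))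
  have h4 := (ordGE (n + 3)).add_mem ((ordGE (n + 3)).sub_mem (ordGE_anti (by omega) h1)
    (ordGE_anti (by omega) h2)) h3
  convert h4 using 1
  have e : ∀ δ : PSeries →ₗ[ℂ] PSeries, expTerm δ (0 + 1) H = δ H := fun δ => by
    simp [expTerm_apply]
  rw [Finset.sum_range_succ', Finset.sum_range_succ', Finset.sum_range_succ',
    Finset.sum_range_succ', expTerm_zero, expTerm_zero, e, e, Finset.sum_sub_distrib, map_sub,
    LinearMap.sub_apply]
  abel

lemma mem_formalHam_of_approx {F : FormalSeries}
    (h : ∀ n, ∃ P ∈ formalHam, ∀ α β, α.degree + β.degree < n → F α β = P α β) :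
    F ∈ formalHam := by
  refine ⟨⟨?_, ?_, ?_⟩, fun α β => ?_, fun α β hm => ?_⟩
  · obtain ⟨P, hP, hF⟩ := h 1
    rw [hF _ _ (by simp)]
    exact hP.1.1
  · obtain ⟨P, hP, hF⟩ := h 2
    rw [hF _ _ (by simp)]
    exact hP.1.2.1
  · obtain ⟨P, hP, hF⟩ := h 2
    rw [hF _ _ (by simp)]
    exact hP.1.2.2
  · obtain ⟨P, hP, hF⟩ := h (α.degree + β.degree + 1)
    rw [hF _ _ (Nat.lt_succ_self _), hF β α (by omega)]
    exact hP.2.1 α β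
  · obtain ⟨P, hP, hF⟩ := h (α.degree + β.degree + 1)
    rw [hF _ _ (Nat.lt_succ_self _)]
    exact hP.2.2 α β hm

lemma mem_ordGE_two {H : FormalSeries} (hH : H ∈ formalHam) : ofCoef H ∈ ordGE 2 :=
  orderGE_mem_ordGE (mem_orderGE_zero hH)

lemma orderGE_anti {m n : ℕ} (h : m ≤ n) : orderGE n ≤ orderGE m :=
  fun _ hF => ⟨hF.1, fun α β hm => hF.2 α β (by omega)⟩

lemma expAd_mem_formalHam {S H : FormalSeries} (hS : S ∈ orderGE 1) (hH : H ∈ formalHam) :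
    expAd S H ∈ formalHam := by
  refine mem_formalHam_of_approx fun n => ?_
  refine ⟨∑ k ∈ Finset.range n, ((k.factorial : ℝ)⁻¹) • (bracket S)^[k] H,
    formalHam.sum_mem fun k _ => formalHam.smul_mem _
      (iterate_bracket_mem hS (mem_orderGE_zero hH) k).1, fun α β hn => ?_⟩
  rw [expAd, finsum_eq_sum_of_support_subset (s := Finset.range n)]
  · simp only [Finset.sum_apply]
    refine Finset.sum_congr rfl fun k _ => ?_
    simp
  · intro k hk
    by_contra hlt
    rw [Finset.mem_coe, Finset.mem_range, not_lt] at hlt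
    refine hk ?_
    simp only
    rw [(iterate_bracket_mem hS (mem_orderGE_zero hH) k).2 α β (by omega), mul_zero]

lemma freq_charge_swap (ω : ℤ → ℝ) (α β : MultiIndex) :
    freq ω (charge β α) = -freq ω (charge α β) := by
  have h : charge β α = -charge α β := (neg_sub _ _).symm
  rw [h, freq, Finsupp.sum_neg_index (by simp), freq, Finsupp.sum, Finsupp.sum,
    ← Finset.sum_neg_distrib]
  refine Finset.sum_congr rfl fun j _ => ?_
  push_cast
  ring

/-- The solution `s`, homogeneous of degree `n + 2`, of `{s, D_ω} = -E` on the off-diagonal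
monomials of that degree. -/
noncomputable def homologicalSol (ω : ℤ → ℝ) (n : ℕ) (E : FormalSeries) : FormalSeries :=
  fun α β => if α ≠ β ∧ α.degree + β.degree = n + 2 then
    Complex.I * E α β / freq ω (charge α β) else 0

lemma homologicalSol_mem (ω : ℤ → ℝ) (n : ℕ) {E : FormalSeries} (hE : E ∈ formalHam) :
    homologicalSol ω n E ∈ orderGE n := by
  refine ⟨⟨⟨if_neg fun h => h.1 rfl, if_neg ?_, if_neg ?_⟩, fun α β => ?_, fun α β hm => ?_⟩,
    fun α β h => if_neg fun h' => h.ne h'.2⟩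
  · simp
  · simp
  · simp only [homologicalSol]
    by_cases h : α ≠ β ∧ α.degree + β.degree = n + 2
    · rw [if_pos h, if_pos ⟨h.1.symm, by omega⟩, freq_charge_swap ω α β]
      simp only [map_div₀, map_mul, Complex.conj_I, ← hE.2.1 α β, Complex.ofReal_neg,
        map_neg, Complex.conj_ofReal]
      rw [neg_mul, neg_div_neg_eq]
    · rw [if_neg h, if_neg fun h' => h ⟨h'.1.symm, by omega⟩, map_zero]
  · simp only [homologicalSol]
    rw [hE.2.2 α β hm, mul_zero, zero_div, ite_self]

/-- Adding to the generator a solution of the homological equation removes the off-diagonal terms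
of the next degree and leaves those of lower degree untouched. -/
lemma exists_improve {ω : ℤ → ℝ} (hω : NonResonant ω) {H : FormalSeries} (hH : H ∈ formalHam)
    (hHD : ofCoef H - ofCoef (quadHam ω) ∈ ordGE 3) {n : ℕ} (hn : 1 ≤ n) {S : FormalSeries}
    (hS : S ∈ orderGE 1)
    (hoff : ∀ α β, α ≠ β → α.degree + β.degree < n + 2 → expAd S H α β = 0) :
    ∃ s ∈ orderGE n, ∀ α β, α ≠ β → α.degree + β.degree < n + 3 → expAd (S + s) H α β = 0 := by
  set s := homologicalSol ω n (expAd S H) with hs'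
  have hs : s ∈ orderGE n := homologicalSol_mem ω n (expAd_mem_formalHam hS hH)
  refine ⟨s, hs, fun α β hne hlt => ?_⟩
  have hSs : S + s ∈ orderGE 1 := (orderGE 1).add_mem hS (orderGE_anti hn hs)
  have hsub : ofCoef (S + s) - ofCoef S = ofCoef s := add_sub_cancel_left (G := PSeries) _ _
  have h1 := formalExp_poisson_sub_mem (n := n) (orderGE_mem_ordGE hS) (orderGE_mem_ordGE hSs)
    (by rw [hsub]; exact orderGE_mem_ordGE hs) (mem_ordGE_two hH) α β hlt
  have h2 := poisson_mem_ordGE (orderGE_mem_ordGE hs) hHD α β (by omega)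
  rw [hsub, map_sub, map_sub, ← expAd_eq hSs, ← expAd_eq hS] at h1
  rw [map_sub, map_sub, poisson_antisymm _ (ofCoef (quadHam ω)), map_neg, coef_poisson_quadHam,
    sub_eq_zero] at h2
  rw [h2] at h1
  change expAd (S + s) H α β - expAd S H α β - -(-(Complex.I * freq ω (charge α β)) * s α β) = 0
    at h1
  have h3 : Complex.I * freq ω (charge α β) * s α β = -expAd S H α β := by
    rw [hs', homologicalSol]
    split_ifs with h
    · have := freq_ne_zero hω hne
      field_simp
      rw [Complex.I_sq, neg_one_mul]
    · rw [hoff α β hne (by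
        have : α.degree + β.degree ≠ n + 2 := fun h' => h ⟨hne, h'⟩
        omega), mul_zero, neg_zero]
  linear_combination h1 + h3

/-- The generators found degree by degree stabilize in each coefficient. -/
lemma exists_normalizing {ω : ℤ → ℝ} (hω : NonResonant ω) {d : ℕ} (hd : 1 ≤ d) {H : FormalSeries}
    (hH : H ∈ formalHam) (hHD : ofCoef H - ofCoef (quadHam ω) ∈ ordGE 3)
    (hoff : ∀ α β, α ≠ β → α.degree + β.degree < d + 2 → H α β = 0) :
    ∃ S ∈ orderGE d, expAd S H ∈ actionHam := by
  have hstep : ∀ (m : ℕ) (S : {S : FormalSeries // S ∈ orderGE d ∧ ∀ α β, α ≠ β →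
      α.degree + β.degree < d + m + 2 → expAd S H α β = 0}),
      ∃ S' : {S : FormalSeries // S ∈ orderGE d ∧ ∀ α β, α ≠ β →
        α.degree + β.degree < d + (m + 1) + 2 → expAd S H α β = 0},
        S'.1 - S.1 ∈ orderGE (d + m) := by
    rintro m ⟨S, hS, hSoff⟩
    obtain ⟨s, hs, hs'⟩ := exists_improve hω hH hHD (n := d + m) (by omega)
      (orderGE_anti hd hS) hSoff
    refine ⟨⟨S + s, (orderGE d).add_mem hS (orderGE_anti (by omega) hs), fun α β h1 h2 =>
      hs' α β h1 (by omega)⟩, ?_⟩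
    simpa using hs
  choose g hg using hstep
  have hzero : expAd 0 H = H := by
    refine (expAd_eq (orderGE 1).zero_mem H).trans ?_
    refine formalExp_eq_self (raisesOrder_poisson (ordGE 3).zero_mem) ?_
    exact (congrArg (fun δ : PSeries →ₗ[ℂ] PSeries => δ (ofCoef H)) (map_zero poisson))
  let T : ∀ m : ℕ, {S : FormalSeries // S ∈ orderGE d ∧ ∀ α β, α ≠ β →
      α.degree + β.degree < d + m + 2 → expAd S H α β = 0} := fun m =>
    Nat.rec ⟨0, (orderGE d).zero_mem, fun α β h1 h2 => by rw [hzero]; exact hoff α β h1 h2⟩ g m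
  have hT : ∀ m, (T (m + 1)).1 - (T m).1 ∈ orderGE (d + m) := fun m => hg m (T m)
  have hT' : ∀ m k, (T (m + k)).1 - (T m).1 ∈ orderGE (d + m) := by
    intro m k
    induction k with
    | zero => simp
    | succ k ih =>
      have := (orderGE (d + m)).add_mem (orderGE_anti (by omega) (hT (m + k))) ih
      rwa [sub_add_sub_cancel] at this
  set S : FormalSeries := fun α β => (T (α.degree + β.degree)).1 α β with hSdef
  have hagree : ∀ m α β, α.degree + β.degree < d + m + 2 → S α β = (T m).1 α β := by
    intro m α β h
    rcases le_total m (α.degree + β.degree) with hm | hm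
    · obtain ⟨k, hk⟩ := Nat.exists_eq_add_of_le hm
      have := (hT' m k).2 α β h
      rw [← hk] at this
      exact sub_eq_zero.1 this
    · obtain ⟨k, hk⟩ := Nat.exists_eq_add_of_le hm
      have := (hT' (α.degree + β.degree) k).2 α β (by omega)
      rw [← hk] at this
      exact (sub_eq_zero.1 this).symm
  have hSmem : S ∈ orderGE d := by
    refine ⟨mem_formalHam_of_approx fun n => ⟨(T n).1, (T n).2.1.1, fun α β h =>
      hagree n α β (by omega)⟩, fun α β h => ?_⟩
    rw [hagree 0 α β (by omega)]
    exact (T 0).2.1.2 α β h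
  refine ⟨S, hSmem, expAd_mem_formalHam (orderGE_anti hd hSmem) hH, fun α β hne => ?_⟩
  set m := α.degree + β.degree with hm
  have hS1 := orderGE_anti hd hSmem
  have hT1 := orderGE_anti hd (T m).2.1
  have hdiff : ofCoef S - ofCoef (T m).1 ∈ ordGE (d + m + 2) := fun a b h => by
    rw [map_sub, coef_ofCoef, coef_ofCoef, hagree m a b h, sub_self]
  have h1 := formalExp_poisson_sub_mem (orderGE_mem_ordGE hT1) (orderGE_mem_ordGE hS1) hdiff
    (mem_ordGE_two hH) α β (by omega)
  have h2 := poisson_mem_ordGE hdiff (mem_ordGE_two hH) α β (by omega)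
  rw [map_sub, h2, sub_zero, ← expAd_eq hS1, ← expAd_eq hT1, map_sub, sub_eq_zero] at h1
  exact Eq.trans h1 ((T m).2.2 α β hne (by omega))

lemma expAd_sub_mem {d : ℕ} (hd : 1 ≤ d) {S H : FormalSeries} (hS : S ∈ orderGE d)
    (hH : H ∈ formalHam) : expAd S H - H ∈ orderGE d := by
  have hS1 := orderGE_anti hd hS
  refine ⟨formalHam.sub_mem (expAd_mem_formalHam hS1 hH) hH, fun α β h => ?_⟩
  have h1 := formalExp_poisson_sub_mem (n := d) (H := ofCoef H) (ordGE 3).zero_mem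
    (orderGE_mem_ordGE hS1) (by rw [sub_zero]; exact orderGE_mem_ordGE hS) (mem_ordGE_two hH)
    α β (by omega)
  have h2 := poisson_mem_ordGE (orderGE_mem_ordGE hS) (mem_ordGE_two hH) α β (by omega)
  rw [sub_zero, map_sub, h2, sub_zero, ← expAd_eq hS1,
    formalExp_eq_self (raisesOrder_poisson (ordGE 3).zero_mem) (by simp)] at h1
  exact h1

/-- The degree `|α| + |α|` of a diagonal monomial is even, so order `1` is order `2`. -/
lemma actionGE_two_of_one {Z : FormalSeries} (hZ : Z ∈ actionHam) (h : Z ∈ orderGE 1) :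
    Z ∈ actionGE 2 := by
  refine ⟨hZ, hZ.1, fun α β hlt => ?_⟩
  by_cases hne : α = β
  · subst hne
    exact h.2 α α (by omega)
  · exact hZ.2 α β hne

lemma expAd_unique {ω : ℤ → ℝ} (hω : NonResonant ω) {H : FormalSeries} (hH : H ∈ formalHam)
    (hHD : ofCoef H - ofCoef (quadHam ω) ∈ ordGE 3) {S G : FormalSeries} (hS : S ∈ orderGE 1)
    (hG : G ∈ orderGE 1) (h1 : expAd S H ∈ actionHam) (h2 : expAd G H ∈ actionHam) :
    expAd G H = expAd S H := by
  have e1 : expAd S H = _ := expAd_eq hS H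
  have e2 : expAd G H = _ := expAd_eq hG H
  have d1 : formalExp (poisson (ofCoef S)) (ofCoef H) ∈ diagSeries := by
    rw [← e1]; exact actionHam_le_diagSeries h1
  have d2 : formalExp (poisson (ofCoef G)) (ofCoef H) ∈ diagSeries := by
    rw [← e2]; exact actionHam_le_diagSeries h2
  refine e2.trans (Eq.trans ?_ e1.symm)
  refine formalExp_eq_of_diag hω (orderGE_mem_ordGE hS) (formalHam_le_momentumZero hS.1)
    (orderGE_mem_ordGE hG) (formalHam_le_momentumZero hG.1) d1 d2 ?_
  have := (ordGE 3).add_mem (formalExp_sub_self_mem (raisesOrder_poisson (orderGE_mem_ordGE hG))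
    (mem_ordGE_two hH)) hHD
  rwa [sub_add_sub_cancel] at this

end FormalBirkhoff

theorem proposition2 (ω : ℤ → ℝ) (hω : FormalBirkhoff.NonResonant ω) (d : ℕ) (hd : 1 ≤ d)
    (H Z R : FormalBirkhoff.FormalSeries)
    (hZ : Z ∈ FormalBirkhoff.actionGE 2) (hR : R ∈ FormalBirkhoff.orderGE d)
    (hH : H = FormalBirkhoff.quadHam ω + Z + R) :
    (∃ S ∈ FormalBirkhoff.orderGE d, ∃ Z' ∈ FormalBirkhoff.actionHam,
      FormalBirkhoff.expAd S H = FormalBirkhoff.quadHam ω + Z' ∧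
      Z' - Z ∈ FormalBirkhoff.actionGE d) ∧
    (∀ S ∈ FormalBirkhoff.orderGE d, ∀ Z' ∈ FormalBirkhoff.actionHam,
      FormalBirkhoff.expAd S H = FormalBirkhoff.quadHam ω + Z' →
      Z' - Z ∈ FormalBirkhoff.actionGE d →
      ∀ G ∈ FormalBirkhoff.orderGE 1,
        FormalBirkhoff.expAd G H ∈ FormalBirkhoff.actionHam →
        FormalBirkhoff.expAd G H = FormalBirkhoff.expAd S H) ∧
    (∃! ZH : FormalBirkhoff.FormalSeries, ZH ∈ FormalBirkhoff.actionGE 2 ∧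
      ∃ S ∈ FormalBirkhoff.orderGE 1,
        FormalBirkhoff.expAd S H = FormalBirkhoff.quadHam ω + ZH) := by
  open FormalBirkhoff in
  have hD := quadHam_mem ω
  have hHmem : H ∈ formalHam := by
    rw [hH]
    exact formalHam.add_mem (formalHam.add_mem hD.1 hZ.1.1) hR.1
  have hHD : ofCoef H - ofCoef (quadHam ω) ∈ ordGE 3 := by
    have h : H - quadHam ω ∈ orderGE 1 := by
      rw [hH, add_assoc, add_sub_cancel_left]
      exact (orderGE 1).add_mem (orderGE_anti one_le_two hZ.2) (orderGE_anti hd hR)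
    exact orderGE_mem_ordGE h
  have hoff : ∀ α β, α ≠ β → α.degree + β.degree < d + 2 → H α β = 0 := fun α β hne hlt => by
    rw [hH, Pi.add_apply, Pi.add_apply, Pi.add_apply, Pi.add_apply, hD.2 α β hne, hZ.1.2 α β hne,
      hR.2 α β hlt, add_zero, add_zero]
  have huniq : ∀ S ∈ orderGE 1, ∀ G ∈ orderGE 1, expAd S H ∈ actionHam → expAd G H ∈ actionHam →
      expAd G H = expAd S H := fun S hS G hG h1 h2 => expAd_unique hω hHmem hHD hS hG h1 h2
  obtain ⟨S, hS, hSK⟩ := exists_normalizing hω hd hHmem hHD hoff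
  set Z' := expAd S H - quadHam ω with hZ'
  have hZ'K : Z' ∈ actionHam := actionHam.sub_mem hSK hD
  have hSZ' : expAd S H = quadHam ω + Z' := (add_sub_cancel _ _).symm
  have hdiff : Z' - Z ∈ actionGE d := by
    refine ⟨actionHam.sub_mem hZ'K hZ.1, ?_⟩
    have h := (orderGE d).add_mem (expAd_sub_mem hd hS hHmem) hR
    have e : expAd S H - H + R = Z' - Z := by
      rw [hZ', hH]
      abel
    rwa [e] at h
  have hZ'2 : Z' ∈ actionGE 2 := by
    have h := (orderGE 1).add_mem (orderGE_anti hd hdiff.2) (orderGE_anti one_le_two hZ.2)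
    rw [sub_add_cancel] at h
    exact actionGE_two_of_one hZ'K h
  refine ⟨⟨S, hS, Z', hZ'K, hSZ', hdiff⟩, ?_, Z', ⟨hZ'2, S, orderGE_anti hd hS, hSZ'⟩, ?_⟩
  · intro S' hS' Z'' hZ'' hE _ G hG hGK
    refine huniq S' (orderGE_anti hd hS') G hG ?_ hGK
    rw [hE]
    exact actionHam.add_mem hD hZ''
  · rintro Y ⟨hY, G, hG, hGY⟩
    have h := huniq S (orderGE_anti hd hS) G hG hSK (by
      rw [hGY]
      exact actionHam.add_mem hD hY.1)
    rw [hGY, hSZ'] at h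
    exact add_left_cancel h
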